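/- **Theorem 3.2.** Let $D$ be a probability distribution of a pair $(X,Y)$ with $Y\in\{-1,1\}$, let $\phi(a)=\ln(1+e^{-a})$ be the logistic loss, and put $Q(f)=E_D\,\phi(f(X)Y)$ and, for an i.i.d. sample $Z_1^m=((X_i,Y_i))_{i\le m}$ from $D$, $\hat Q(f)=\frac1m\sum_{i=1}^m\phi(f(X_i)Y_i)$. Let $S$ be a set of measurable real-valued functions of $x$ with $|g(x)|\le 1$ for all $g\in S$ and all $x$, closed under negation, such that for all $n$ and $e\in\mathbb R^n$ the supremum $\sup_{g\in S}\sum_{i=1}^n e_i g(X_i)$ is measurable (with respect to the completion of the law of the sample). For $f\in\mathrm{span}(S)$ let $\|f\|_1=\inf\{\sum_j|w_j| : f=\sum_j w_j g_j,\ g_j\in S\}$ (finite sums), and let $R_m(S)=E_{Z_1^m}E_\sigma\sup_{g\in S}\frac1m\sum_{i=1}^m\sigma_i g(X_i)$ with $\sigma$ uniform on $\{-1,1\}^m$. Assume that $R_m(S)\le C_S/\sqrt m$ for all $m\ge1$, where $C_S>0$ is a constant. For every $m\ge 1$ let $0<h_0(m)\le 1/\sqrt m$ and let $\beta_m\ge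 0$ be such that $k(m)=\beta_m/h_0(m)$ is a nonnegative integer. For (almost) every sample $Z_1^m$ run $k(m)$ steps of greedy boosting from $\hat f_0=0$: at step $k$, with a closed set $\Lambda_k\subset\mathbb R$ such that $0\in\Lambda_k=-\Lambda_k$ and $\sup\Lambda_k=h_0(m)$, and a tolerance $0\le\varepsilon_k\le h_0(m)^2/2$, put $\hat f_{k+1}=\hat f_k+\hat\alpha_k\hat g_k$, where $\hat\alpha_k\in\Lambda_k$ and $\hat g_k\in S$ satisfy $$\hat Q(\hat f_k+\hat\alpha_k\hat g_k)\le\inf_{\alpha\in\Lambda_k,\,g\in S}\hat Q(\hat f_k+\alpha g)+\varepsilon_k .$$ Write $\hat f=\hat f_{k(m)}$, and assume that $Q(\hat f)$ is a measurable function of the sample. Then, for every $m\ge1$, $Q(\hat f)$ is integrable and $$E_{Z_1^m}Q(\hat f)\le\inf_{\bar f\in\mathrm{span}(S)}\left[Q(\bar f)+\frac{(2C_S+1)\beta_m}{\sqrt m}+\frac{\|\bar f\|_1+1}{\sqrt m}+\frac{\|\bar f\|_1}{\|\bar f\|_1+\beta_m}\right]$$ (where $0/0=0$). Consequently, for all constants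 $c_1,c_2>0$ and every $\bar f\in\mathrm{span}(S)$ (in particular for a minimizer of $Q$ over $\mathrm{span}(S)$, if there is one): 1. if $c_1m^{1/4}\le\beta_m\le c_2m^{1/4}$ for all large $m$, then for all large $m$ $$E_{Z_1^m}Q(\hat f)\le Q(\bar f)+\Big((2C_S+1)c_2+\|\bar f\|_1+1+\frac{\|\bar f\|_1}{c_1}\Big)m^{-1/4};$$ 2. if $c_1\|\bar f\|_1^{1/2}m^{1/4}\le\beta_m\le c_2\|\bar f\|_1^{1/2}m^{1/4}$ for all large $m$, then for all large $m$ $$E_{Z_1^m}Q(\hat f)\le Q(\bar f)+\Big((2C_S+1)c_2+1+\frac1{c_1}\Big)\|\bar f\|_1^{1/2}\,m^{-1/4}.$$ -/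

import Mathlib

open MeasureTheory Filter

noncomputable section

namespace Boosting

variable {X Z : Type*}

/-- The 1-norm with respect to the basis `S`: the infimum of the `ℓ¹`-norms of the coefficient
vectors over all finite representations of `f` by elements of `S`. It is used for
`f ∈ Submodule.span ℝ S`, where the set of representations is non-empty. -/
def oneNorm (S : Set (X → ℝ)) (f : X → ℝ) : ℝ :=
  sInf {r : ℝ | ∃ (n : ℕ) (w : Fin n → ℝ) (g : Fin n → X → ℝ),
    (∀ j, g j ∈ S) ∧ f = ∑ j, w j • g j ∧ r = ∑ j, |w j|}

/-- The logistic loss `φ(a) = ln (1 + e^{-a})`. -/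
def logisticLoss (a : ℝ) : ℝ := Real.log (1 + Real.exp (-a))

/-- The true risk `Q(f) = E_D φ(f(X) Y)`. -/
def risk [MeasurableSpace X] (D : Measure (X × ℝ)) (f : X → ℝ) : ℝ :=
  ∫ z, logisticLoss (f z.1 * z.2) ∂D

/-- The empirical risk `(1/m) ∑ φ(f(X_i) Y_i)` on the sample `z`. -/
def empiricalRisk {m : ℕ} (z : Fin m → X × ℝ) (f : X → ℝ) : ℝ :=
  (1 / (m : ℝ)) * ∑ i, logisticLoss (f (z i).1 * (z i).2)

/-- The value `±1` of a sign. -/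
def signValue (b : Bool) : ℝ := if b then 1 else -1

/-- The one-sided sample-dependent Rademacher complexity
`E_σ sup_{g ∈ G} (1/m) ∑ σ_i g(z_i)`, where `σ` is uniform on `{-1, 1}^m`.
(It is used for classes of uniformly bounded functions, where the supremum is finite.) -/
def empiricalRademacher (G : Set (Z → ℝ)) {m : ℕ} (z : Fin m → Z) : ℝ :=
  (1 / 2 ^ m : ℝ) * ∑ σ : Fin m → Bool,
    ⨆ g : G, (1 / (m : ℝ)) * ∑ i, signValue (σ i) * (g : Z → ℝ) (z i)

/-- The expected Rademacher complexity `R_m(G)` over `m` i.i.d. samples from `D`. -/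
def rademacherComplexity [MeasurableSpace Z] (D : Measure Z) (G : Set (Z → ℝ)) (m : ℕ) : ℝ :=
  ∫ z, empiricalRademacher G z ∂(Measure.pi fun _ : Fin m => D)

/-- A class `G` is a measurable class for `D` (in the sense of empirical process theory) if the
suprema over `G` of weighted sums over i.i.d. samples are random variables, i.e. are measurable
with respect to the completion of the law of the sample. -/
def IsMeasurableClass [MeasurableSpace Z] (D : Measure Z) (G : Set (Z → ℝ)) : Prop :=
  ∀ (n : ℕ) (e : Fin n → ℝ),
    AEMeasurable (fun z : Fin n → Z => ⨆ g : G, ∑ i, e i * (g : Z → ℝ) (z i))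
      (Measure.pi fun _ : Fin n => D)

/-- The functions of the covariate in `S`, seen as functions of the pair `(x, y)`. -/
def asPairClass (S : Set (X → ℝ)) : Set (X × ℝ → ℝ) :=
  (fun (g : X → ℝ) (z : X × ℝ) => g z.1) '' S

/-- `f 0, …, f K` are the iterates of `K` steps of greedy boosting for the objective `A` over the
basis `S`, started at `f₀`, with sets of admissible step sizes `Λ k` and tolerances `ε k`.
Approximate minimization means
`A (f k + ᾱ ḡ) ≤ inf_{α ∈ Λ k, g ∈ S} A (f k + α g) + ε k`, written out without the infimum. -/
structure IsGreedyBoosting (S : Set (X → ℝ)) (A : (X → ℝ) → ℝ) (f₀ : X → ℝ)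
    (Λ : ℕ → Set ℝ) (ε : ℕ → ℝ) (K : ℕ) (f : ℕ → X → ℝ) : Prop where
  start_mem : f₀ ∈ Submodule.span ℝ S
  start : f 0 = f₀
  isClosed : ∀ k < K, IsClosed (Λ k)
  zero_mem : ∀ k < K, (0 : ℝ) ∈ Λ k
  neg_mem : ∀ k < K, ∀ α ∈ Λ k, -α ∈ Λ k
  tol_nonneg : ∀ k < K, 0 ≤ ε k
  step : ∀ k < K, ∃ α ∈ Λ k, ∃ g ∈ S, f (k + 1) = f k + α • g ∧
    ∀ α' ∈ Λ k, ∀ g' ∈ S, A (f k + α • g) ≤ A (f k + α' • g') + ε k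

end Boosting

end

/-!
The excess risk of boosting is split into a deterministic optimization error on the sample, and a
generalization error which is uniform over the functions of 1-norm at most `β = k h₀`.

*Optimization* (`IsGreedyBoosting.excess_le`). The logistic loss is convex with second derivative
at most `1`. Since an approximately optimal step of size at most `h` does at least as well as the
step of size `h` along any `g ∈ S`, the decrease of the objective bounds the directional
derivatives along `S`, hence, by duality with the 1-norm, the derivative in the direction
`fbar - f_j`, whose 1-norm is at most `j h + ‖fbar‖₁`. By convexity that derivative bounds the
excess of the objective, and `(j h + ‖fbar‖₁)` times the excess grows by at most
`((j + 1) h + ‖fbar‖₁) h²` per step. After `k` steps the excess is at most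
`‖fbar‖₁ / (‖fbar‖₁ + β) + β h₀`, because the initial excess is at most `ln 2 ≤ 1`.

*Generalization* (`integral_le_of_le_risk_sub_empiricalRisk`). The deviation of the risk from the
empirical risk is compared with a second, independent sample. The supremum of the difference of the
two empirical risks over the class need not be shown measurable: for every sign vector, exchanging
coordinates between the samples bounds the difference pointwise by two signed suprema, each of a
single sample which again has law `D^m`. Averaging over the signs and applying the contraction
principle `sum_iSup_signs_le` gives `2 β R_m(S)`.

The signed suprema of losses are not weighted sums, so their measurability is not assumed. It
follows since the value vectors of the class on a sample form a convex set whose support function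
is measurable by assumption; the distance to a convex set is a countable supremum of expressions
in its support function, and the supremum of a Lipschitz function over a set is a countable
supremum of expressions in the distance (`aemeasurable_iSup_of_supportFunction`).
-/

noncomputable section

namespace Boosting

/-! ### The logistic loss -/

/-- The derivative of the logistic loss. -/
def logisticLossDeriv (a : ℝ) : ℝ := -(1 + Real.exp a)⁻¹

lemma hasDerivAt_logisticLoss (a : ℝ) : HasDerivAt logisticLoss (logisticLossDeriv a) a := by
  have hpos : 1 + Real.exp (-a) ≠ 0 := by positivity
  have h := (((hasDerivAt_id a).neg.exp).const_add 1).log (by simpa using hpos)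
  have heq : logisticLossDeriv a = Real.exp (-a) * -1 / (1 + Real.exp (-a)) := by
    unfold logisticLossDeriv
    rw [Real.exp_neg]
    have := Real.exp_pos a
    field_simp
    ring
  rw [heq]
  exact h

lemma monotone_logisticLossDeriv : Monotone logisticLossDeriv := by
  intro a b hab
  unfold logisticLossDeriv
  have := Real.exp_le_exp.mpr hab
  gcongr

lemma abs_logisticLossDeriv_le (a : ℝ) : |logisticLossDeriv a| ≤ 1 := by
  unfold logisticLossDeriv
  rw [abs_neg, abs_of_pos (by positivity)]
  exact inv_le_one_of_one_le₀ (by linarith [Real.exp_pos a])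

/-- The logistic loss has second derivative at most `1`, expressed without second derivatives. -/
lemma monotone_add_logisticLossDeriv : Monotone fun a => a - logisticLossDeriv a := by
  have hd : ∀ a : ℝ, HasDerivAt (fun a => a - logisticLossDeriv a)
      (1 - Real.exp a / (1 + Real.exp a) ^ 2) a := by
    intro a
    have h := (hasDerivAt_id a).sub
      (((Real.hasDerivAt_exp a).const_add 1).inv (by positivity)).neg
    exact h.congr_deriv (by ring)
  refine monotone_of_deriv_nonneg (fun a => (hd a).differentiableAt) fun a => ?_
  rw [(hd a).deriv, sub_nonneg, div_le_one (by positivity)]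
  nlinarith [Real.exp_pos a]

lemma tangent_le_of_monotone_deriv {k k' : ℝ → ℝ} (hk : ∀ x, HasDerivAt k (k' x) x)
    (hmono : Monotone k') (a b : ℝ) : k a + k' a * (b - a) ≤ k b := by
  have hder : deriv k = k' := funext fun x => (hk x).deriv
  have hconv : ConvexOn ℝ Set.univ k :=
    MonotoneOn.convexOn_of_deriv convex_univ
      (fun x _ => (hk x).continuousAt.continuousWithinAt)
      (fun x _ => (hk x).differentiableAt.differentiableWithinAt)
      (by rw [hder]; exact hmono.monotoneOn _)
  rcases lt_trichotomy a b with h | h | h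
  · have := hconv.le_slope_of_hasDerivAt trivial trivial h (hk a)
    rw [slope_def_field, le_div_iff₀ (by linarith)] at this
    linarith
  · simp [h]
  · have := hconv.slope_le_of_hasDerivAt trivial trivial h (hk a)
    rw [slope_def_field, div_le_iff₀ (by linarith)] at this
    linarith

lemma logisticLoss_tangent_le (a b : ℝ) :
    logisticLoss a + logisticLossDeriv a * (b - a) ≤ logisticLoss b :=
  tangent_le_of_monotone_deriv hasDerivAt_logisticLoss monotone_logisticLossDeriv a b

lemma logisticLoss_le_quadratic (a b : ℝ) :
    logisticLoss b ≤ logisticLoss a + logisticLossDeriv a * (b - a) + (b - a) ^ 2 / 2 := by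
  have h := tangent_le_of_monotone_deriv (k := fun x => x ^ 2 / 2 - logisticLoss x)
    (k' := fun x => x - logisticLossDeriv x)
    (fun x => by
      have := ((hasDerivAt_pow 2 x).div_const 2).sub (hasDerivAt_logisticLoss x)
      exact this.congr_deriv (by simp))
    monotone_add_logisticLossDeriv a b
  nlinarith

lemma abs_logisticLoss_sub_le (a b : ℝ) : |logisticLoss a - logisticLoss b| ≤ |a - b| := by
  have key : ∀ a b : ℝ, logisticLoss a - logisticLoss b ≤ |a - b| := fun a b => by
    have h1 := logisticLoss_tangent_le a b
    have h2 : |logisticLossDeriv a * (b - a)| ≤ 1 * |a - b| := by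
      rw [abs_mul, abs_sub_comm b a]
      exact mul_le_mul_of_nonneg_right (abs_logisticLossDeriv_le a) (abs_nonneg _)
    have h3 := neg_abs_le (logisticLossDeriv a * (b - a))
    linarith
  exact abs_le.mpr ⟨by have := key b a; rw [abs_sub_comm b a] at this; linarith, key a b⟩

lemma logisticLoss_nonneg (a : ℝ) : 0 ≤ logisticLoss a :=
  Real.log_nonneg (by linarith [Real.exp_pos (-a)])

lemma logisticLoss_zero_le : logisticLoss 0 ≤ 1 := by
  have := Real.log_le_sub_one_of_pos (show (0 : ℝ) < 2 by norm_num)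
  unfold logisticLoss
  norm_num at this ⊢
  linarith

lemma logisticLoss_le (a : ℝ) : logisticLoss a ≤ 1 + |a| := by
  have h := (abs_le.mp (abs_logisticLoss_sub_le a 0)).2
  rw [sub_zero] at h
  linarith [logisticLoss_zero_le]

lemma continuous_logisticLoss : Continuous logisticLoss :=
  continuous_iff_continuousAt.mpr fun a => (hasDerivAt_logisticLoss a).continuousAt

/-! ### The contraction principle -/

lemma abs_signValue (b : Bool) : |signValue b| = 1 := by cases b <;> simp [signValue]

lemma abs_sum_signValue_mul_le {n : ℕ} (σ : Fin n → Bool) (a : Fin n → ℝ) :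
    |∑ i, signValue (σ i) * a i| ≤ ∑ i, |a i| := by
  refine (Finset.abs_sum_le_sum_abs _ _).trans (le_of_eq ?_)
  simp [abs_mul, abs_signValue]

/-- The contraction principle for a single sign. -/
lemma iSup_add_add_iSup_sub_le {ι : Type*} [Nonempty ι] {v s t : ι → ℝ}
    (hst : ∀ p q, |s p - s q| ≤ |t p - t q|)
    (h1 : BddAbove (Set.range fun p => v p + t p)) (h2 : BddAbove (Set.range fun p => v p - t p)) :
    (⨆ p, (v p + s p)) + (⨆ p, (v p - s p)) ≤ (⨆ p, (v p + t p)) + (⨆ p, (v p - t p)) := by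
  have key : ∀ p q, (v p + s p) + (v q - s q) ≤ (⨆ p, (v p + t p)) + (⨆ p, (v p - t p)) := by
    intro p q
    have hs := (le_abs_self _).trans (hst p q)
    have a1 := le_ciSup h1 p
    have a2 := le_ciSup h1 q
    have a3 := le_ciSup h2 p
    have a4 := le_ciSup h2 q
    rcases abs_cases (t p - t q) with h | h <;> linarith
  have h3 : ∀ q, (⨆ p, (v p + s p)) ≤
      (⨆ p, (v p + t p)) + (⨆ p, (v p - t p)) - (v q - s q) := fun q =>
    ciSup_le fun p => by linarith [key p q]
  have h4 : (⨆ q, (v q - s q)) ≤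
      (⨆ p, (v p + t p)) + (⨆ p, (v p - t p)) - (⨆ p, (v p + s p)) :=
    ciSup_le fun q => by linarith [h3 q]
  linarith

lemma sum_signs_succ {n : ℕ} (F : (Fin (n + 1) → Bool) → ℝ) :
    ∑ σ, F σ = ∑ τ : Fin n → Bool, (F (Fin.cons true τ) + F (Fin.cons false τ)) := by
  rw [← (Fin.consEquiv fun _ => Bool).sum_comp, Fintype.sum_prod_type]
  simp [Fin.consEquiv, Finset.sum_add_distrib]

lemma bddAbove_range_of_abs_le {ι : Type*} {a : ι → ℝ} {B : ℝ} (h : ∀ p, |a p| ≤ B) :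
    BddAbove (Set.range a) :=
  ⟨B, by rintro _ ⟨p, rfl⟩; exact (le_abs_self _).trans (h p)⟩

/-- The contraction principle for Rademacher averages (one-sided, without absolute values): if
the increments of each `s i` are dominated by those of `t i`, then the signed average of the
suprema is at most as large for `s` as for `t`. The offset `u` is there for the induction over
the coordinates. -/
lemma sum_iSup_signs_le {ι : Type*} [Nonempty ι] {n : ℕ} {s t : Fin n → ι → ℝ} {u : ι → ℝ}
    (hst : ∀ i p q, |s i p - s i q| ≤ |t i p - t i q|) (hu : ∃ B, ∀ p, |u p| ≤ B)
    (hs : ∃ B, ∀ i p, |s i p| ≤ B) (ht : ∃ B, ∀ i p, |t i p| ≤ B) :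
    ∑ σ : Fin n → Bool, (⨆ p, (u p + ∑ i, signValue (σ i) * s i p)) ≤
      ∑ σ : Fin n → Bool, (⨆ p, (u p + ∑ i, signValue (σ i) * t i p)) := by
  induction n generalizing u with
  | zero => simp
  | succ n ih =>
    obtain ⟨Bu, hBu⟩ := hu
    obtain ⟨Bs, hBs⟩ := hs
    obtain ⟨Bt, hBt⟩ := ht
    have hoff : ∀ c : ℝ, |c| = 1 → ∃ B, ∀ p, |u p + c * s 0 p| ≤ B := fun c hc =>
      ⟨Bu + Bs, fun p => (abs_add_le _ _).trans
        (add_le_add (hBu p) (by rw [abs_mul, hc, one_mul]; exact hBs 0 p))⟩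
    have hstep : ∀ c : ℝ, |c| = 1 → _ := fun c hc =>
      ih (s := fun i => s i.succ) (t := fun i => t i.succ)
        (fun i => hst i.succ) (hoff c hc) ⟨Bs, fun i => hBs i.succ⟩ ⟨Bt, fun i => hBt i.succ⟩
    rw [sum_signs_succ, sum_signs_succ]
    simp only [Fin.sum_univ_succ, Fin.cons_zero, Fin.cons_succ, ← add_assoc]
    rw [Finset.sum_add_distrib]
    refine (add_le_add (hstep _ (abs_signValue true)) (hstep _ (abs_signValue false))).trans ?_
    rw [← Finset.sum_add_distrib]
    refine Finset.sum_le_sum fun τ _ => ?_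
    have hv : ∀ p, |u p + ∑ i, signValue (τ i) * t i.succ p| ≤ Bu + n * Bt := fun p => by
      refine (abs_add_le _ _).trans (add_le_add (hBu p) ?_)
      refine (abs_sum_signValue_mul_le _ _).trans ?_
      refine (Finset.sum_le_sum fun i _ => hBt i.succ p).trans ?_
      simp
    have h := iSup_add_add_iSup_sub_le (v := fun p => u p + ∑ i, signValue (τ i) * t i.succ p)
      (hst 0)
      (bddAbove_range_of_abs_le (B := Bu + n * Bt + Bt) fun p =>
        (abs_add_le _ _).trans (add_le_add (hv p) (hBt 0 p)))
      (bddAbove_range_of_abs_le (B := Bu + n * Bt + Bt) fun p =>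
        (abs_sub _ _).trans (add_le_add (hv p) (hBt 0 p)))
    simpa only [signValue, if_true, Bool.false_eq_true, if_false, one_mul, neg_mul,
      ← sub_eq_add_neg, add_right_comm, add_sub_right_comm] using h

/-! ### Suprema over random convex sets -/

lemma bddAbove_inner_image {E : Type*} [NormedAddCommGroup E] [InnerProductSpace ℝ E] {K : Set E}
    {R : ℝ} (hR : ∀ t ∈ K, ‖t‖ ≤ R) (e : E) :
    BddAbove (Set.range fun t : K => inner ℝ e (t : E)) := by
  refine ⟨‖e‖ * R, ?_⟩
  rintro _ ⟨t, rfl⟩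
  exact (real_inner_le_norm _ _).trans (mul_le_mul_of_nonneg_left (hR t t.2) (norm_nonneg _))

/-- The distance to a bounded convex set is determined by the values of the support function of
the set at countably many directions. -/
lemma infDist_eq_iSup_denseSeq {E : Type*} [NormedAddCommGroup E] [InnerProductSpace ℝ E]
    [ProperSpace E] {K : Set E} (hne : K.Nonempty) (hconv : Convex ℝ K) {R : ℝ}
    (hR : ∀ t ∈ K, ‖t‖ ≤ R) (q : E) :
    haveI : Nonempty (Metric.closedBall (0 : E) 1) := ⟨⟨0, by simp⟩⟩
    Metric.infDist q K = ⨆ j : ℕ,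
      (inner ℝ (TopologicalSpace.denseSeq (Metric.closedBall (0 : E) 1) j : E) q
        - ⨆ t : K, inner ℝ (TopologicalSpace.denseSeq (Metric.closedBall (0 : E) 1) j : E)
            (t : E)) := by
  have : Nonempty (Metric.closedBall (0 : E) 1) := ⟨⟨0, by simp⟩⟩
  have : Nonempty K := hne.to_subtype
  have hupper : ∀ e : Metric.closedBall (0 : E) 1,
      inner ℝ (e : E) q - (⨆ t : K, inner ℝ (e : E) (t : E)) ≤ Metric.infDist q K := by
    intro e
    rw [Metric.infDist_eq_iInf]
    refine le_ciInf fun t => ?_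
    have h1 := le_ciSup (bddAbove_inner_image hR (e : E)) t
    have h2 : inner ℝ (e : E) (q - t) ≤ 1 * ‖q - t‖ :=
      (real_inner_le_norm _ _).trans
        (mul_le_mul_of_nonneg_right (mem_closedBall_zero_iff.mp e.2) (norm_nonneg _))
    rw [inner_sub_right] at h2
    rw [dist_eq_norm]
    linarith
  apply le_antisymm
  · -- the unit vector pointing from the projection of `q` to `q` attains the distance
    have hcl : IsComplete (closure K) := isClosed_closure.isComplete
    obtain ⟨p, hp, hmin⟩ :=
      exists_norm_eq_iInf_of_complete_convex hne.closure hcl hconv.closure q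
    have hinner := (norm_eq_iInf_iff_real_inner_le_zero hconv.closure hp).mp hmin
    have hdist : Metric.infDist q K = ‖q - p‖ := by
      rw [← Metric.infDist_closure, Metric.infDist_eq_iInf, hmin]
      simp only [dist_eq_norm]
    obtain ⟨e₀, he₀, hval, hle⟩ : ∃ e₀ : E, ‖e₀‖ ≤ 1 ∧ inner ℝ e₀ (q - p) = ‖q - p‖ ∧
        ∀ t ∈ K, inner ℝ e₀ t ≤ inner ℝ e₀ p := by
      by_cases h0 : ‖q - p‖ = 0
      · exact ⟨0, by simp, by simp [h0], by simp⟩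
      · refine ⟨‖q - p‖⁻¹ • (q - p), by simp [norm_smul, h0], ?_, fun t ht => ?_⟩
        · rw [real_inner_smul_left, real_inner_self_eq_norm_sq]
          field_simp
        · have := hinner t (subset_closure ht)
          rw [inner_sub_right] at this
          rw [real_inner_smul_left, real_inner_smul_left]
          exact mul_le_mul_of_nonneg_left (by linarith) (by positivity)
    have hbdd : BddAbove (Set.range fun j : ℕ =>
        (inner ℝ (TopologicalSpace.denseSeq (Metric.closedBall (0 : E) 1) j : E) q
        - ⨆ t : K, inner ℝ (TopologicalSpace.denseSeq (Metric.closedBall (0 : E) 1) j : E)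
            (t : E))) :=
      ⟨_, by rintro _ ⟨j, rfl⟩; exact hupper _⟩
    have hR0 : 0 ≤ R := (norm_nonneg _).trans (hR _ hne.some_mem)
    rw [hdist]
    refine le_of_forall_pos_sub_le fun δ hδ => ?_
    set η : ℝ := δ / (R + ‖q‖ + 1) with hη
    have hηpos : 0 < η := by positivity
    obtain ⟨j, hj⟩ := (TopologicalSpace.denseRange_denseSeq
      (Metric.closedBall (0 : E) 1)).exists_dist_lt ⟨e₀, by simpa using he₀⟩ hηpos
    refine le_trans ?_ (le_ciSup hbdd j)
    set e : E := (TopologicalSpace.denseSeq (Metric.closedBall (0 : E) 1) j : E)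
    have hnorm : ‖e - e₀‖ ≤ η := by
      rw [Subtype.dist_eq, dist_comm, dist_eq_norm] at hj
      exact hj.le
    have hclose : ∀ t : E, |inner ℝ e t - inner ℝ e₀ t| ≤ η * ‖t‖ := fun t => by
      rw [← inner_sub_left]
      exact (abs_real_inner_le_norm _ _).trans
        (mul_le_mul_of_nonneg_right hnorm (norm_nonneg _))
    have h1 : (⨆ t : K, inner ℝ e (t : E)) ≤ inner ℝ e₀ p + η * R :=
      ciSup_le fun t => by
        have h2 := (abs_le.mp (hclose t)).2
        have h3 := mul_le_mul_of_nonneg_left (hR t t.2) hηpos.le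
        linarith [hle t t.2]
    have h2 := (abs_le.mp (hclose q)).1
    rw [inner_sub_right] at hval
    have h3 : η * (R + ‖q‖ + 1) = δ := by rw [hη]; field_simp
    nlinarith
  · exact ciSup_le fun j => hupper _

/-- A Lipschitz function has the same supremum over `K` as its lower envelope
`q ↦ ψ q - L d(q, K)` has over a countable dense set. -/
lemma iSup_eq_iSup_denseSeq_sub_infDist {E : Type*} [PseudoMetricSpace E] [Nonempty E]
    [TopologicalSpace.SeparableSpace E] {K : Set E} (hne : K.Nonempty) {L : ℝ} (hL : 0 ≤ L)
    {ψ : E → ℝ} (hψ : ∀ s t, |ψ s - ψ t| ≤ L * dist s t)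
    (hb : BddAbove (Set.range fun t : K => ψ t)) :
    (⨆ t : K, ψ t) = ⨆ j : ℕ, (ψ (TopologicalSpace.denseSeq E j)
      - L * Metric.infDist (TopologicalSpace.denseSeq E j) K) := by
  have : Nonempty K := hne.to_subtype
  have hupper : ∀ q, ψ q - L * Metric.infDist q K ≤ ⨆ t : K, ψ t := by
    intro q
    refine le_of_forall_pos_le_add fun δ hδ => ?_
    obtain ⟨t, ht, hdt⟩ := (Metric.infDist_lt_iff (x := q) hne).mp
      (show Metric.infDist q K < Metric.infDist q K + δ / (L + 1) by
        have : 0 < δ / (L + 1) := by positivity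
        linarith)
    have h1 := le_ciSup hb ⟨t, ht⟩
    have h2 := (abs_le.mp (hψ q t)).2
    have h3 := mul_le_mul_of_nonneg_left hdt.le hL
    have h4 : L * (δ / (L + 1)) ≤ δ := by
      rw [mul_div_assoc', div_le_iff₀ (by positivity)]
      nlinarith
    linarith
  apply le_antisymm
  · refine ciSup_le fun t => le_of_forall_pos_sub_le fun δ hδ => ?_
    obtain ⟨j, hj⟩ := (TopologicalSpace.denseRange_denseSeq E).exists_dist_lt (t : E)
      (show 0 < δ / (2 * L + 1) by positivity)
    refine le_trans ?_ (le_ciSup (f := fun j : ℕ => ψ (TopologicalSpace.denseSeq E j)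
      - L * Metric.infDist (TopologicalSpace.denseSeq E j) K)
      ⟨_, by rintro _ ⟨j, rfl⟩; exact hupper _⟩ j)
    have h1 := (abs_le.mp (hψ (t : E) (TopologicalSpace.denseSeq E j))).2
    have h2 := Metric.infDist_le_dist_of_mem (x := TopologicalSpace.denseSeq E j) t.2
    rw [dist_comm] at h2
    have h3 := mul_le_mul_of_nonneg_left h2 hL
    have h4 := mul_le_mul_of_nonneg_left hj.le hL
    have h5 : 2 * (L * (δ / (2 * L + 1))) ≤ δ := by
      rw [mul_div_assoc', mul_div_assoc', div_le_iff₀ (by positivity)]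
      nlinarith
    linarith
  · exact ciSup_le fun j => hupper _

/-- If the support function of a random bounded convex set is measurable in every direction, then
so is the supremum over the set of every random Lipschitz function. -/
lemma aemeasurable_iSup_of_supportFunction {Ω E : Type*} [MeasurableSpace Ω] {μ : Measure Ω}
    [NormedAddCommGroup E] [InnerProductSpace ℝ E] [ProperSpace E] {K : Ω → Set E}
    (hne : ∀ ω, (K ω).Nonempty) (hconv : ∀ ω, Convex ℝ (K ω)) {R : ℝ}
    (hR : ∀ ω, ∀ t ∈ K ω, ‖t‖ ≤ R)
    (hsupp : ∀ e : E, AEMeasurable (fun ω => ⨆ t : K ω, inner ℝ e (t : E)) μ)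
    {L : ℝ} (hL : 0 ≤ L) {ψ : E → Ω → ℝ} (hψ : ∀ t, AEMeasurable (ψ t) μ)
    (hlip : ∀ᵐ ω ∂μ, ∀ s t, |ψ s ω - ψ t ω| ≤ L * dist s t) :
    AEMeasurable (fun ω => ⨆ t : K ω, ψ t ω) μ := by
  have : Nonempty (Metric.closedBall (0 : E) 1) := ⟨⟨0, by simp⟩⟩
  have hdist : ∀ q : E, AEMeasurable (fun ω => Metric.infDist q (K ω)) μ := fun q => by
    simp_rw [fun ω => infDist_eq_iSup_denseSeq (hne ω) (hconv ω) (hR ω) q]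
    exact AEMeasurable.iSup fun j => aemeasurable_const.sub (hsupp _)
  have hmeas : AEMeasurable (fun ω => ⨆ j : ℕ, (ψ (TopologicalSpace.denseSeq E j) ω
      - L * Metric.infDist (TopologicalSpace.denseSeq E j) (K ω))) μ :=
    AEMeasurable.iSup fun j => (hψ _).sub ((hdist _).const_mul L)
  refine hmeas.congr ?_
  filter_upwards [hlip] with ω hω
  refine (iSup_eq_iSup_denseSeq_sub_infDist (ψ := fun t => ψ t ω) (hne ω) hL hω ?_).symm
  refine ⟨ψ 0 ω + L * R, ?_⟩
  rintro _ ⟨t, rfl⟩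
  have h1 := (abs_le.mp (hω t 0)).2
  rw [dist_zero_right] at h1
  have h2 := mul_le_mul_of_nonneg_left (hR ω t t.2) hL
  linarith

variable {X : Type*}

/-! ### The 1-norm -/

lemma exists_representation {S : Set (X → ℝ)} {f : X → ℝ} (hf : f ∈ Submodule.span ℝ S) :
    ∃ (n : ℕ) (w : Fin n → ℝ) (g : Fin n → X → ℝ), (∀ j, g j ∈ S) ∧ f = ∑ j, w j • g j := by
  obtain ⟨n, w, g, h⟩ := Submodule.mem_span_set'.mp hf
  exact ⟨n, w, fun j => g j, fun j => (g j).2, h.symm⟩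

lemma oneNorm_nonneg (S : Set (X → ℝ)) (f : X → ℝ) : 0 ≤ oneNorm S f := by
  refine Real.sInf_nonneg ?_
  rintro _ ⟨n, w, g, -, -, rfl⟩
  exact Finset.sum_nonneg fun _ _ => abs_nonneg _

/-- The 1-norm dominates every linear functional which is bounded by `1` on the basis. -/
lemma apply_le_oneNorm_mul {S : Set (X → ℝ)} {f : X → ℝ} (hf : f ∈ Submodule.span ℝ S)
    (ℓ : (X → ℝ) →ₗ[ℝ] ℝ) {δ : ℝ} (hδ : 0 ≤ δ) (hℓ : ∀ g ∈ S, |ℓ g| ≤ δ) :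
    ℓ f ≤ oneNorm S f * δ := by
  have hrep : ∀ (n : ℕ) (w : Fin n → ℝ) (g : Fin n → X → ℝ), (∀ j, g j ∈ S) →
      f = ∑ j, w j • g j → ℓ f ≤ (∑ j, |w j|) * δ := by
    rintro n w g hg rfl
    rw [map_sum, Finset.sum_mul]
    refine Finset.sum_le_sum fun j _ => ?_
    rw [map_smul, smul_eq_mul]
    exact (le_abs_self _).trans
      ((abs_mul _ _).le.trans (mul_le_mul_of_nonneg_left (hℓ _ (hg j)) (abs_nonneg _)))
  obtain ⟨n, w, g, hg, hw⟩ := exists_representation hf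
  rcases hδ.eq_or_lt with rfl | hpos
  · simpa using hrep n w g hg hw
  · rw [← div_le_iff₀ hpos]
    refine le_csInf ⟨_, n, w, g, hg, hw, rfl⟩ ?_
    rintro _ ⟨n, w, g, hg, hw, rfl⟩
    rw [div_le_iff₀ hpos]
    exact hrep n w g hg hw

lemma abs_le_oneNorm {S : Set (X → ℝ)} (hS : ∀ g ∈ S, ∀ x, |g x| ≤ 1) {f : X → ℝ}
    (hf : f ∈ Submodule.span ℝ S) (x : X) : |f x| ≤ oneNorm S f := by
  have h1 := apply_le_oneNorm_mul hf (LinearMap.proj x) zero_le_one fun g hg => hS g hg x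
  have h2 := apply_le_oneNorm_mul hf (-LinearMap.proj x) zero_le_one
    fun g hg => by simpa using hS g hg x
  simp only [LinearMap.proj_apply, LinearMap.neg_apply, mul_one] at h1 h2
  exact abs_le.mpr ⟨by linarith, h1⟩

/-! ### Numerical convergence of greedy boosting -/

/-- A step of greedy boosting is at least as good as the step of size `h` along every element of
the basis, and does not make the objective worse than the tolerance allows. -/
lemma IsGreedyBoosting.step_le {S : Set (X → ℝ)} {A : (X → ℝ) → ℝ} {f₀ : X → ℝ} {Λ : ℕ → Set ℝ}
    {ε : ℕ → ℝ} {K : ℕ} {f : ℕ → X → ℝ} (hf : IsGreedyBoosting S A f₀ Λ ε K f) {h : ℝ}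
    (hΛ : ∀ j < K, IsLUB (Λ j) h) {j : ℕ} (hj : j < K) :
    (∀ g ∈ S, A (f (j + 1)) ≤ A (f j + h • g) + ε j) ∧ A (f (j + 1)) ≤ A (f j) + ε j := by
  obtain ⟨α, -, g, hg, hstep, hmin⟩ := hf.step j hj
  rw [hstep]
  refine ⟨fun g' hg' => hmin h ?_ g' hg', ?_⟩
  · exact (hΛ j hj).mem_of_isClosed ⟨0, hf.zero_mem j hj⟩ (hf.isClosed j hj)
  · simpa using hmin 0 (hf.zero_mem j hj) g hg

lemma IsGreedyBoosting.exists_step {S : Set (X → ℝ)} {A : (X → ℝ) → ℝ} {f₀ : X → ℝ}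
    {Λ : ℕ → Set ℝ} {ε : ℕ → ℝ} {K : ℕ} {f : ℕ → X → ℝ} (hf : IsGreedyBoosting S A f₀ Λ ε K f)
    {h : ℝ} (hΛ : ∀ j < K, IsLUB (Λ j) h) {j : ℕ} (hj : j < K) :
    ∃ α : ℝ, |α| ≤ h ∧ ∃ g ∈ S, f (j + 1) = f j + α • g := by
  obtain ⟨α, hα, g, hg, hstep, -⟩ := hf.step j hj
  have h1 := (hΛ j hj).1 hα
  have h2 := (hΛ j hj).1 (hf.neg_mem j hj α hα)
  exact ⟨α, abs_le.mpr ⟨by linarith, h1⟩, g, hg, hstep⟩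

/-- After `j` steps of size at most `h`, started at `0`, the iterate has 1-norm at most `j h`, in
the form of a bound for linear functionals. -/
lemma IsGreedyBoosting.abs_apply_le {S : Set (X → ℝ)} {A : (X → ℝ) → ℝ} {Λ : ℕ → Set ℝ}
    {ε : ℕ → ℝ} {K : ℕ} {f : ℕ → X → ℝ} (hf : IsGreedyBoosting S A 0 Λ ε K f) {h : ℝ}
    (hΛ : ∀ j < K, IsLUB (Λ j) h) (ℓ : (X → ℝ) →ₗ[ℝ] ℝ) {δ : ℝ}
    (hℓ : ∀ g ∈ S, |ℓ g| ≤ δ) {j : ℕ} (hj : j ≤ K) : |ℓ (f j)| ≤ j * h * δ := by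
  induction j with
  | zero => simp [hf.start]
  | succ j ih =>
    obtain ⟨α, hα, g, hg, hstep⟩ := hf.exists_step hΛ (Nat.lt_of_succ_le hj)
    rw [hstep, map_add, map_smul, smul_eq_mul]
    have h1 : |α * ℓ g| ≤ h * δ := by
      rw [abs_mul]
      exact mul_le_mul hα (hℓ g hg) (abs_nonneg _) ((abs_nonneg _).trans hα)
    have h2 := ih (by omega)
    push_cast
    linarith [abs_add_le (ℓ (f j)) (α * ℓ g)]

/-- The recursion behind the convergence of greedy boosting. Here `T` stands for the 1-norm of the
iterate plus that of the reference function, `h` for the step size, and `a`, `a'` for the excess of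
the objective before and after the step. -/
lemma mul_max_le_of_step {T h a a' e : ℝ} (hT : 0 ≤ T) (hh : 0 < h) (he : 0 ≤ e)
    (hstep : h * a ≤ T * (a - a' + e)) (hmono : a' ≤ a + e) :
    (T + h) * max a' 0 ≤ T * max a 0 + (T + h) * e := by
  have hTh : 0 < T + h := by linarith
  rcases le_total a 0 with ha | ha
  · rw [max_eq_right ha]
    have : max a' 0 ≤ e := max_le (by linarith) he
    nlinarith
  · rw [max_eq_left ha]
    rcases le_total a' 0 with ha' | ha'
    · rw [max_eq_right ha', mul_zero]
      positivity
    · rw [max_eq_left ha']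
      rcases hT.eq_or_lt with rfl | hTpos
      · nlinarith
      · -- `(T + h)(T - h) ≤ T²`
        have h1 : T * ((T + h) * (a' - e)) ≤ T * (T * a) := by
          have h2 : T * (a' - e) ≤ (T - h) * a := by linarith
          have h3 := mul_le_mul_of_nonneg_left h2 hTh.le
          nlinarith [mul_nonneg (sq_nonneg h) ha]
        have := le_of_mul_le_mul_left h1 hTpos
        linarith

/-- Numerical convergence of greedy boosting with restricted step sizes, for a convex objective
whose second derivative along the elements of the basis is at most `1`. -/
lemma IsGreedyBoosting.excess_le {S : Set (X → ℝ)} (hS : ∀ g ∈ S, -g ∈ S) {A : (X → ℝ) → ℝ}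
    (hA : ∀ f, ∃ ℓ : (X → ℝ) →ₗ[ℝ] ℝ, (∀ f', A f + ℓ (f' - f) ≤ A f') ∧
      ∀ g ∈ S, ∀ α : ℝ, A (f + α • g) ≤ A f + α * ℓ g + α ^ 2 / 2)
    {Λ : ℕ → Set ℝ} {ε : ℕ → ℝ} {K : ℕ} {f : ℕ → X → ℝ}
    (hf : IsGreedyBoosting S A 0 Λ ε K f) {h : ℝ} (hh : 0 < h)
    (hΛ : ∀ j < K, IsLUB (Λ j) h) (hε : ∀ j < K, ε j ≤ h ^ 2 / 2) {fbar : X → ℝ}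
    (hfbar : fbar ∈ Submodule.span ℝ S) :
    (K * h + oneNorm S fbar) * max (A (f K) - A fbar) 0 ≤
      oneNorm S fbar * max (A 0 - A fbar) 0 + K * ((K * h + oneNorm S fbar) * h ^ 2) := by
  have hN := oneNorm_nonneg S fbar
  have key : ∀ j ≤ K, (j * h + oneNorm S fbar) * max (A (f j) - A fbar) 0 ≤
      oneNorm S fbar * max (A 0 - A fbar) 0 + j * ((K * h + oneNorm S fbar) * h ^ 2) := by
    intro j
    induction j with
    | zero => intro _; simp [hf.start]
    | succ j ih =>
      intro hj
      have hjK : j < K := Nat.lt_of_succ_le hj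
      have hjK' : ((j : ℝ) + 1) ≤ K := by exact_mod_cast hj
      obtain ⟨hbest, hmono⟩ := hf.step_le hΛ hjK
      have hεj := hε j hjK
      have hε0 := hf.tol_nonneg j hjK
      obtain ⟨ℓ, htan, hquad⟩ := hA (f j)
      -- `δ` bounds the derivative of the objective along the basis: otherwise the step of size
      -- `h` along some element of the basis would be better than the step that was made
      set δ : ℝ := (A (f j) - A (f (j + 1)) + h ^ 2) / h with hδdef
      have hδh : δ * h = A (f j) - A (f (j + 1)) + h ^ 2 := by
        rw [hδdef]; field_simp
      have hδ : 0 ≤ δ := div_nonneg (by nlinarith) hh.le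
      have hlow : ∀ g ∈ S, -δ ≤ ℓ g := fun g hg => by
        have h1 := hbest g hg
        have h2 := hquad g hg h
        have h3 : 0 ≤ h * (ℓ g + δ) := by nlinarith
        have h4 := nonneg_of_mul_nonneg_right h3 hh
        linarith
      have hℓ : ∀ g ∈ S, |ℓ g| ≤ δ := fun g hg => by
        have h1 := hlow g hg
        have h2 := hlow _ (hS g hg)
        rw [map_neg] at h2
        exact abs_le.mpr ⟨h1, by linarith⟩
      have hdir : -((j * h + oneNorm S fbar) * δ) ≤ ℓ (fbar - f j) := by
        have h1 := apply_le_oneNorm_mul hfbar (-ℓ) hδ fun g hg => by simpa using hℓ g hg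
        have h2 := (abs_le.mp (hf.abs_apply_le hΛ ℓ hℓ hjK.le)).2
        rw [LinearMap.neg_apply] at h1
        rw [map_sub]
        linarith
      have hT : 0 ≤ j * h + oneNorm S fbar := by positivity
      have hstep := mul_max_le_of_step (a := A (f j) - A fbar) (a' := A (f (j + 1)) - A fbar)
        (e := h ^ 2) hT hh (by positivity)
        (by
          have h1 : A (f j) - A fbar ≤ (j * h + oneNorm S fbar) * δ := by
            linarith [htan fbar]
          have h2 := mul_le_mul_of_nonneg_left h1 hh.le
          have h3 : h * ((j * h + oneNorm S fbar) * δ) =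
              (j * h + oneNorm S fbar) * (δ * h) := by ring
          rw [h3, hδh] at h2
          linarith)
        (by nlinarith)
      have hlast : (j * h + oneNorm S fbar + h) * h ^ 2 ≤
          (K * h + oneNorm S fbar) * h ^ 2 :=
        mul_le_mul_of_nonneg_right (by nlinarith) (by positivity)
      have := ih hjK.le
      push_cast
      nlinarith
  exact key K le_rfl

/-! ### The hypothesis class of boosting -/

open scoped Pointwise in
/-- The dilation by `b` of the convex hull of `0` and the basis. For a symmetric basis and `b ≥ 0`,
these are the combinations of elements of the basis with coefficients of total absolute value at
most `b`; in this form the class is visibly convex, and is `{0}` when the basis is empty. -/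
def scaledHull (S : Set (X → ℝ)) (b : ℝ) : Set (X → ℝ) := b • convexHull ℝ (insert 0 S)

lemma convex_scaledHull (S : Set (X → ℝ)) (b : ℝ) : Convex ℝ (scaledHull S b) :=
  (convex_convexHull ℝ _).smul b

lemma zero_mem_scaledHull (S : Set (X → ℝ)) (b : ℝ) : 0 ∈ scaledHull S b :=
  ⟨0, subset_convexHull ℝ _ (Set.mem_insert _ _), smul_zero b⟩

lemma smul_mem_scaledHull {S : Set (X → ℝ)} (b : ℝ) {g : X → ℝ} (hg : g ∈ S) :
    b • g ∈ scaledHull S b :=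
  ⟨g, subset_convexHull ℝ _ (Set.mem_insert_of_mem _ hg), rfl⟩

instance (S : Set (X → ℝ)) (b : ℝ) : Nonempty (scaledHull S b) := ⟨⟨0, zero_mem_scaledHull S b⟩⟩

lemma add_smul_mem_scaledHull {S : Set (X → ℝ)} (hS : ∀ g ∈ S, -g ∈ S) {b h α : ℝ} (hb : 0 ≤ b)
    (hα : |α| ≤ h) {f g : X → ℝ} (hf : f ∈ scaledHull S b) (hg : g ∈ S) :
    f + α • g ∈ scaledHull S (b + h) := by
  have hh : 0 ≤ h := (abs_nonneg α).trans hα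
  unfold scaledHull at hf ⊢
  rw [(convex_convexHull ℝ _).add_smul hb hh]
  refine Set.add_mem_add hf ?_
  have hzero : (0 : X → ℝ) ∈ convexHull ℝ (insert 0 S) :=
    subset_convexHull ℝ _ (Set.mem_insert _ _)
  have hmem : ∀ g ∈ S, ∀ c : ℝ, 0 ≤ c → c ≤ h →
      ∃ v ∈ convexHull ℝ (insert 0 S), h • v = c • g := fun g hg c hc0 hc => by
    rcases hh.eq_or_lt with rfl | hpos
    · exact ⟨0, hzero, by simp [le_antisymm hc hc0]⟩
    · refine ⟨(c / h) • g, (convex_convexHull ℝ _).smul_mem_of_zero_mem hzero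
        (subset_convexHull ℝ _ (Set.mem_insert_of_mem _ hg))
        ⟨by positivity, (div_le_one hpos).mpr hc⟩, ?_⟩
      rw [smul_smul, mul_div_cancel₀ _ hpos.ne']
  rcases le_total 0 α with h0 | h0
  · exact hmem g hg α h0 ((le_abs_self α).trans hα)
  · obtain ⟨v, hv, hval⟩ := hmem (-g) (hS g hg) (-α) (by linarith) ((neg_le_abs α).trans hα)
    exact ⟨v, hv, by simpa using hval⟩

/-- Iterates of greedy boosting belong to the hypothesis class of their total step size. -/
lemma IsGreedyBoosting.mem_scaledHull {S : Set (X → ℝ)} (hS : ∀ g ∈ S, -g ∈ S)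
    {A : (X → ℝ) → ℝ} {Λ : ℕ → Set ℝ} {ε : ℕ → ℝ} {K : ℕ} {f : ℕ → X → ℝ}
    (hf : IsGreedyBoosting S A 0 Λ ε K f) {h : ℝ} (hh : 0 ≤ h) (hΛ : ∀ j < K, IsLUB (Λ j) h)
    {j : ℕ} (hj : j ≤ K) : f j ∈ scaledHull S (j * h) := by
  induction j with
  | zero => rw [hf.start]; exact zero_mem_scaledHull _ _
  | succ j ih =>
    obtain ⟨α, hα, g, hg, hstep⟩ := hf.exists_step hΛ (Nat.lt_of_succ_le hj)
    rw [hstep, Nat.cast_succ, add_one_mul]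
    exact add_smul_mem_scaledHull hS (by positivity) hα (ih (by omega)) hg

lemma apply_le_of_mem_scaledHull {S : Set (X → ℝ)} {b : ℝ} (hb : 0 ≤ b)
    (ℓ : (X → ℝ) →ₗ[ℝ] ℝ) {δ : ℝ} (hδ : 0 ≤ δ) (hℓ : ∀ g ∈ S, ℓ g ≤ δ) {f : X → ℝ}
    (hf : f ∈ scaledHull S b) : ℓ f ≤ b * δ := by
  obtain ⟨v, hv, rfl⟩ := hf
  have hsub : convexHull ℝ (insert 0 S) ⊆ {v | ℓ v ≤ δ} := by
    refine convexHull_min ?_ (convex_halfSpace_le ℓ.isLinear δ)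
    rintro g (rfl | hg)
    · simpa using hδ
    · exact hℓ g hg
  simpa using mul_le_mul_of_nonneg_left (hsub hv) hb

lemma abs_le_of_mem_scaledHull {S : Set (X → ℝ)} (hS : ∀ g ∈ S, ∀ x, |g x| ≤ 1) {b : ℝ}
    (hb : 0 ≤ b) {f : X → ℝ} (hf : f ∈ scaledHull S b) (x : X) : |f x| ≤ b := by
  have h1 := apply_le_of_mem_scaledHull hb (LinearMap.proj x) zero_le_one
    (fun g hg => (abs_le.mp (hS g hg x)).2) hf
  have h2 := apply_le_of_mem_scaledHull hb (-LinearMap.proj x) zero_le_one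
    (fun g hg => by simpa using neg_le.mp (abs_le.mp (hS g hg x)).1) hf
  simp only [LinearMap.proj_apply, LinearMap.neg_apply, mul_one] at h1 h2
  exact abs_le.mpr ⟨by linarith, h1⟩

lemma measurable_of_mem_span [MeasurableSpace X] {S : Set (X → ℝ)} (hS : ∀ g ∈ S, Measurable g)
    {f : X → ℝ} (hf : f ∈ Submodule.span ℝ S) : Measurable f := by
  obtain ⟨n, w, g, hg, rfl⟩ := exists_representation hf
  convert Finset.measurable_sum Finset.univ fun j _ => (hS _ (hg j)).const_smul (w j) using 1
  funext x
  simp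

lemma scaledHull_subset_span (S : Set (X → ℝ)) (b : ℝ) :
    scaledHull S b ⊆ Submodule.span ℝ S := by
  rintro _ ⟨v, hv, rfl⟩
  refine Submodule.smul_mem _ _ ?_
  refine convexHull_min ?_ (Submodule.span ℝ S).convex hv
  rintro g (rfl | hg)
  · exact Submodule.zero_mem _
  · exact Submodule.subset_span hg

lemma abs_ciSup_le {ι : Type*} [Nonempty ι] {a : ι → ℝ} {B : ℝ} (h : ∀ p, |a p| ≤ B) :
    |⨆ p, a p| ≤ B := by
  have p := Classical.arbitrary ι
  exact abs_le.mpr ⟨(abs_le.mp (h p)).1.trans (le_ciSup (bddAbove_range_of_abs_le h) p),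
    ciSup_le fun p => (abs_le.mp (h p)).2⟩

lemma iSup_apply_nonneg {S : Set (X → ℝ)} (hS : ∀ g ∈ S, -g ∈ S) (ℓ : (X → ℝ) →ₗ[ℝ] ℝ) {B : ℝ}
    (hB : ∀ g ∈ S, |ℓ g| ≤ B) : 0 ≤ ⨆ g : S, ℓ (g : X → ℝ) := by
  have hbdd : BddAbove (Set.range fun g : S => ℓ (g : X → ℝ)) :=
    bddAbove_range_of_abs_le fun g => hB g g.2
  rcases isEmpty_or_nonempty S with h | ⟨⟨g, hg⟩⟩
  · simp
  · have h1 := le_ciSup hbdd ⟨g, hg⟩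
    have h2 := le_ciSup hbdd ⟨-g, hS g hg⟩
    simp only [map_neg] at h1 h2
    linarith

lemma iSup_scaledHull_apply {S : Set (X → ℝ)} (hS : ∀ g ∈ S, -g ∈ S) {b : ℝ} (hb : 0 ≤ b)
    (ℓ : (X → ℝ) →ₗ[ℝ] ℝ) {B : ℝ} (hB : ∀ g ∈ S, |ℓ g| ≤ B) :
    ⨆ f : scaledHull S b, ℓ (f : X → ℝ) = b * ⨆ g : S, ℓ (g : X → ℝ) := by
  have hbdd : BddAbove (Set.range fun g : S => ℓ (g : X → ℝ)) :=
    bddAbove_range_of_abs_le fun g => hB g g.2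
  have hle : ∀ f : scaledHull S b, ℓ (f : X → ℝ) ≤ b * ⨆ g : S, ℓ (g : X → ℝ) := fun f =>
    apply_le_of_mem_scaledHull hb ℓ (iSup_apply_nonneg hS ℓ hB)
      (fun g hg => le_ciSup hbdd ⟨g, hg⟩) f.2
  have hbdd' : BddAbove (Set.range fun f : scaledHull S b => ℓ (f : X → ℝ)) :=
    ⟨_, by rintro _ ⟨f, rfl⟩; exact hle f⟩
  refine le_antisymm (ciSup_le hle) ?_
  rw [Real.mul_iSup_of_nonneg hb]
  refine Real.iSup_le (fun g => ?_) ?_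
  · have := le_ciSup hbdd' ⟨_, smul_mem_scaledHull b g.2⟩
    simpa using this
  · have := le_ciSup hbdd' ⟨_, zero_mem_scaledHull S b⟩
    simpa using this

lemma iSup_asPairClass (S : Set (X → ℝ)) (F : (X × ℝ → ℝ) → ℝ) :
    ⨆ g : asPairClass S, F g = ⨆ g : S, F fun z => (g : X → ℝ) z.1 :=
  ((Set.imageFactorization_surjective (f := fun (g : X → ℝ) (z : X × ℝ) => g z.1)
    (s := S)).iSup_comp fun g : asPairClass S => F g).symm

/-- The weighted sum of the values on a sample of covariates, as a linear functional. -/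
def weightedSum {n : ℕ} (e : Fin n → ℝ) (x : Fin n → X) : (X → ℝ) →ₗ[ℝ] ℝ :=
  ∑ i, e i • LinearMap.proj (x i)

lemma weightedSum_apply {n : ℕ} (e : Fin n → ℝ) (x : Fin n → X) (f : X → ℝ) :
    weightedSum e x f = ∑ i, e i * f (x i) := by
  simp [weightedSum]

lemma abs_weightedSum_le {S : Set (X → ℝ)} (hS : ∀ g ∈ S, ∀ x, |g x| ≤ 1) {n : ℕ}
    (e : Fin n → ℝ) (x : Fin n → X) {g : X → ℝ} (hg : g ∈ S) :
    |weightedSum e x g| ≤ ∑ i, |e i| := by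
  rw [weightedSum_apply]
  refine (Finset.abs_sum_le_sum_abs _ _).trans (Finset.sum_le_sum fun i _ => ?_)
  rw [abs_mul]
  exact mul_le_of_le_one_right (abs_nonneg _) (hS g hg _)

/-! ### Symmetrization and the generalization bound -/

/-- The supremum over the hypothesis class of the signed sum of the losses on a sample. -/
def signedLossSup (S : Set (X → ℝ)) (b : ℝ) {m : ℕ} (σ : Fin m → Bool) (z : Fin m → X × ℝ) : ℝ :=
  ⨆ f : scaledHull S b,
    ∑ i, signValue (σ i) * logisticLoss ((f : X → ℝ) (z i).1 * (z i).2)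

lemma abs_logisticLoss_mul_le {S : Set (X → ℝ)} (hS : ∀ g ∈ S, ∀ x, |g x| ≤ 1) {b : ℝ}
    (hb : 0 ≤ b) {f : X → ℝ} (hf : f ∈ scaledHull S b) (z : X × ℝ) :
    |logisticLoss (f z.1 * z.2)| ≤ 1 + b * |z.2| := by
  rw [abs_of_nonneg (logisticLoss_nonneg _)]
  refine (logisticLoss_le _).trans ?_
  rw [abs_mul]
  have := mul_le_mul_of_nonneg_right (abs_le_of_mem_scaledHull hS hb hf z.1) (abs_nonneg z.2)
  linarith

lemma abs_signed_sum_le {S : Set (X → ℝ)} (hS : ∀ g ∈ S, ∀ x, |g x| ≤ 1) {b : ℝ} (hb : 0 ≤ b)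
    {m : ℕ} (σ : Fin m → Bool) (z : Fin m → X × ℝ) (f : scaledHull S b) :
    |∑ i, signValue (σ i) * logisticLoss ((f : X → ℝ) (z i).1 * (z i).2)| ≤
      ∑ i, (1 + b * |(z i).2|) :=
  (abs_sum_signValue_mul_le σ _).trans
    (Finset.sum_le_sum fun i _ => abs_logisticLoss_mul_le hS hb f.2 (z i))

lemma le_signedLossSup {S : Set (X → ℝ)} (hS : ∀ g ∈ S, ∀ x, |g x| ≤ 1) {b : ℝ} (hb : 0 ≤ b)
    {m : ℕ} (σ : Fin m → Bool) (z : Fin m → X × ℝ) {f : X → ℝ} (hf : f ∈ scaledHull S b) :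
    ∑ i, signValue (σ i) * logisticLoss (f (z i).1 * (z i).2) ≤ signedLossSup S b σ z :=
  le_ciSup (bddAbove_range_of_abs_le (abs_signed_sum_le hS hb σ z)) ⟨f, hf⟩

section Generalization

variable [MeasurableSpace X] {D : Measure (X × ℝ)} [IsProbabilityMeasure D]

lemma ae_abs_label_eq_one (hY : ∀ᵐ z ∂D, z.2 = 1 ∨ z.2 = -1) (m : ℕ) :
    ∀ᵐ z ∂(Measure.pi fun _ : Fin m => D), ∀ i, |(z i).2| = 1 := by
  refine ae_all_iff.mpr fun i => ?_
  have h : ∀ᵐ z ∂D, |z.2| = 1 := by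
    filter_upwards [hY] with z hz
    rcases hz with hz | hz <;> simp [hz]
  exact (Measure.tendsto_eval_ae_ae (μ := fun _ : Fin m => D) (i := i)).eventually h

/-- The values of a function on a sample of covariates, as a vector of a Euclidean space. -/
def sampleValues {X : Type*} {m : ℕ} (z : Fin m → X × ℝ) : (X → ℝ) →ₗ[ℝ] EuclideanSpace ℝ (Fin m) :=
  (WithLp.linearEquiv 2 ℝ (Fin m → ℝ)).symm.toLinearMap ∘ₗ
    LinearMap.pi fun i => LinearMap.proj (z i).1

lemma sampleValues_apply {X : Type*} {m : ℕ} (z : Fin m → X × ℝ) (f : X → ℝ) (i : Fin m) :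
    sampleValues z f i = f (z i).1 := rfl

lemma iSup_image_coe {α E : Type*} (u : α → E) (s : Set α) (F : E → ℝ) :
    ⨆ t : u '' s, F t = ⨆ f : s, F (u f) :=
  ((Set.imageFactorization_surjective (f := u) (s := s)).iSup_comp
    fun t : u '' s => F t).symm

/-- The set of value vectors of the hypothesis class is convex, and its support function is `b`
times the supremum of a weighted sum over the basis, hence measurable. -/
lemma aemeasurable_signedLossSup (hY : ∀ᵐ z ∂D, z.2 = 1 ∨ z.2 = -1) {S : Set (X → ℝ)}
    (hSbound : ∀ g ∈ S, ∀ x, |g x| ≤ 1) (hSneg : ∀ g ∈ S, -g ∈ S)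
    (hSclass : IsMeasurableClass D (asPairClass S)) {b : ℝ} (hb : 0 ≤ b) {m : ℕ}
    (σ : Fin m → Bool) :
    AEMeasurable (signedLossSup S b σ) (Measure.pi fun _ : Fin m => D) := by
  have h := aemeasurable_iSup_of_supportFunction (μ := Measure.pi fun _ : Fin m => D)
    (K := fun z => sampleValues z '' scaledHull S b) (R := √(m * b ^ 2)) (L := m)
    (ψ := fun t z => ∑ i, signValue (σ i) * logisticLoss (t i * (z i).2))
    (fun z => Set.Nonempty.image _ ⟨0, zero_mem_scaledHull S b⟩)
    (fun z => (convex_scaledHull S b).linear_image _) ?_ ?_ (Nat.cast_nonneg m) ?_ ?_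
  · refine h.congr (Eventually.of_forall fun z => ?_)
    simp only
    rw [iSup_image_coe (sampleValues z) (scaledHull S b)
      (fun t => ∑ i, signValue (σ i) * logisticLoss (t i * (z i).2))]
    rfl
  · rintro z _ ⟨f, hf, rfl⟩
    rw [EuclideanSpace.norm_eq]
    refine Real.sqrt_le_sqrt ?_
    have : ∀ i ∈ Finset.univ, ‖sampleValues z f i‖ ^ 2 ≤ b ^ 2 := fun i _ => by
      rw [sampleValues_apply, Real.norm_eq_abs]
      exact pow_le_pow_left₀ (abs_nonneg _) (abs_le_of_mem_scaledHull hSbound hb hf _) 2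
    simpa using Finset.sum_le_card_nsmul _ _ _ this
  · intro e
    have heq : (fun z : Fin m → X × ℝ => ⨆ t : sampleValues z '' scaledHull S b,
        inner ℝ e (t : EuclideanSpace ℝ (Fin m))) =
        fun z => b * ⨆ g : asPairClass S, ∑ i, e i * (g : X × ℝ → ℝ) (z i) := by
      funext z
      rw [iSup_image_coe (sampleValues z) (scaledHull S b) (fun t => inner ℝ e t),
        iSup_asPairClass S (fun g => ∑ i, e i * g (z i))]
      have := iSup_scaledHull_apply hSneg hb (weightedSum (fun i => e i) fun i => (z i).1)
        (fun g hg => abs_weightedSum_le hSbound _ _ hg)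
      simp only [weightedSum_apply] at this
      rw [← this]
      congr 1
      funext f
      simp [PiLp.inner_apply, sampleValues_apply, mul_comm]
    rw [heq]
    exact (hSclass m fun i => e i).const_mul b
  · intro t
    refine Measurable.aemeasurable (Finset.measurable_sum _ fun i _ => ?_)
    exact (continuous_logisticLoss.measurable.comp
      ((measurable_snd.comp (measurable_pi_apply i)).const_mul (t i))).const_mul _
  · filter_upwards [ae_abs_label_eq_one hY m] with z hz s t
    rw [← Finset.sum_sub_distrib]
    refine (Finset.abs_sum_le_sum_abs _ _).trans ?_
    have : ∀ i ∈ Finset.univ, |signValue (σ i) * logisticLoss (s i * (z i).2) -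
        signValue (σ i) * logisticLoss (t i * (z i).2)| ≤ dist s t := fun i _ => by
      rw [← mul_sub, abs_mul, abs_signValue, one_mul]
      refine (abs_logisticLoss_sub_le _ _).trans ?_
      rw [← sub_mul, abs_mul, hz i, mul_one, dist_eq_norm]
      exact PiLp.norm_apply_le (s - t) i
    simpa using Finset.sum_le_card_nsmul _ _ _ this

lemma integrable_signedLossSup (hY : ∀ᵐ z ∂D, z.2 = 1 ∨ z.2 = -1) {S : Set (X → ℝ)}
    (hSbound : ∀ g ∈ S, ∀ x, |g x| ≤ 1) (hSneg : ∀ g ∈ S, -g ∈ S)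
    (hSclass : IsMeasurableClass D (asPairClass S)) {b : ℝ} (hb : 0 ≤ b) {m : ℕ}
    (σ : Fin m → Bool) :
    Integrable (signedLossSup S b σ) (Measure.pi fun _ : Fin m => D) := by
  refine Integrable.of_bound (aemeasurable_signedLossSup hY hSbound hSneg hSclass hb
    σ).aestronglyMeasurable (m * (1 + b)) ?_
  filter_upwards [ae_abs_label_eq_one hY m] with z hz
  refine (abs_ciSup_le (abs_signed_sum_le hSbound hb σ z)).trans (le_of_eq ?_)
  simp [hz, mul_add]

/-- The sample composed of the coordinates of the first sample where the sign is positive, and of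
those of the second sample where it is negative. -/
def mixSamples {Z : Type*} {m : ℕ} (σ : Fin m → Bool) (p : (Fin m → Z) × (Fin m → Z)) :
    Fin m → Z := fun i => if σ i then p.1 i else p.2 i

lemma measurePreserving_mixSamples {Z : Type*} [MeasurableSpace Z] (D : Measure Z)
    [IsProbabilityMeasure D] {m : ℕ} (σ : Fin m → Bool) :
    MeasurePreserving (mixSamples σ)
      ((Measure.pi fun _ : Fin m => D).prod (Measure.pi fun _ : Fin m => D))
      (Measure.pi fun _ : Fin m => D) := by
  have h1 := (measurePreserving_arrowProdEquivProdArrow Z Z (Fin m) (fun _ => D)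
    (fun _ => D)).symm
  have h2 := measurePreserving_pi (fun _ : Fin m => D.prod D) (fun _ : Fin m => D)
    (f := fun i q => if σ i then q.1 else q.2) fun i => by
      cases σ i
      · simpa using measurePreserving_snd
      · simpa using measurePreserving_fst
  exact h2.comp h1

lemma integral_comp_mixSamples {Z : Type*} [MeasurableSpace Z] (D : Measure Z)
    [IsProbabilityMeasure D] {m : ℕ} (σ : Fin m → Bool) {F : (Fin m → Z) → ℝ}
    (hF : AEStronglyMeasurable F (Measure.pi fun _ : Fin m => D)) :
    ∫ p, F (mixSamples σ p)
      ∂((Measure.pi fun _ : Fin m => D).prod (Measure.pi fun _ : Fin m => D)) =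
      ∫ z, F z ∂(Measure.pi fun _ : Fin m => D) := by
  have h := measurePreserving_mixSamples D σ
  conv_rhs => rw [← h.map_eq]
  rw [integral_map h.aemeasurable (by rwa [h.map_eq])]

/-- Exchanging coordinates between the two samples according to the signs turns the difference of
the losses into two signed sums, each over a single sample. -/
lemma sum_loss_sub_le {X : Type*} {S : Set (X → ℝ)} (hS : ∀ g ∈ S, ∀ x, |g x| ≤ 1) {b : ℝ}
    (hb : 0 ≤ b) {m : ℕ} (σ : Fin m → Bool) (z z' : Fin m → X × ℝ) {f : X → ℝ}
    (hf : f ∈ scaledHull S b) :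
    (∑ i, logisticLoss (f (z' i).1 * (z' i).2)) - ∑ i, logisticLoss (f (z i).1 * (z i).2) ≤
      signedLossSup S b σ (mixSamples (fun i => !σ i) (z, z')) +
        signedLossSup S b (fun i => !σ i) (mixSamples σ (z, z')) := by
  refine le_trans (le_of_eq ?_) (add_le_add
    (le_signedLossSup hS hb σ (mixSamples (fun i => !σ i) (z, z')) hf)
    (le_signedLossSup hS hb (fun i => !σ i) (mixSamples σ (z, z')) hf))
  rw [← Finset.sum_sub_distrib, ← Finset.sum_add_distrib]
  refine Finset.sum_congr rfl fun i _ => ?_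
  cases h : σ i <;> simp [mixSamples, signValue, h] <;> ring

lemma integrable_loss (hY : ∀ᵐ z ∂D, z.2 = 1 ∨ z.2 = -1) {f : X → ℝ} (hf : Measurable f) {b : ℝ}
    (hfb : ∀ x, |f x| ≤ b) : Integrable (fun z : X × ℝ => logisticLoss (f z.1 * z.2)) D := by
  refine Integrable.of_bound (Measurable.aestronglyMeasurable
    (continuous_logisticLoss.measurable.comp
      ((hf.comp measurable_fst).mul measurable_snd))) (1 + b) ?_
  filter_upwards [hY] with z hz
  have h1 : |z.2| = 1 := by rcases hz with hz | hz <;> simp [hz]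
  rw [Real.norm_eq_abs, abs_of_nonneg (logisticLoss_nonneg _)]
  refine (logisticLoss_le _).trans ?_
  rw [abs_mul, h1, mul_one]
  linarith [hfb z.1]

lemma integrable_empiricalRisk {f : X → ℝ}
    (hf : Integrable (fun z : X × ℝ => logisticLoss (f z.1 * z.2)) D) (m : ℕ) :
    Integrable (fun z => empiricalRisk z f) (Measure.pi fun _ : Fin m => D) :=
  (integrable_finsetSum _ fun i _ => integrable_comp_eval (μ := fun _ : Fin m => D) (i := i)
    hf).const_mul _

lemma integral_empiricalRisk {f : X → ℝ}
    (hf : Integrable (fun z : X × ℝ => logisticLoss (f z.1 * z.2)) D) {m : ℕ} (hm : 1 ≤ m) :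
    ∫ z, empiricalRisk z f ∂(Measure.pi fun _ : Fin m => D) = risk D f := by
  unfold empiricalRisk
  rw [integral_const_mul, integral_finsetSum _ fun i _ =>
    integrable_comp_eval (μ := fun _ : Fin m => D) (i := i) hf]
  have : ∀ i : Fin m, ∫ z : Fin m → X × ℝ, logisticLoss (f (z i).1 * (z i).2)
      ∂(Measure.pi fun _ : Fin m => D) = risk D f := fun i =>
    integral_comp_eval (μ := fun _ : Fin m => D) (i := i) hf.aestronglyMeasurable
  simp only [this, Finset.sum_const, Finset.card_univ, Fintype.card_fin, nsmul_eq_mul]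
  have : (m : ℝ) ≠ 0 := by positivity
  field_simp

/-- The contraction principle for the logistic loss, on a fixed sample. -/
lemma sum_signedLossSup_le {X : Type*} {S : Set (X → ℝ)} (hSbound : ∀ g ∈ S, ∀ x, |g x| ≤ 1)
    (hSneg : ∀ g ∈ S, -g ∈ S) {b : ℝ} (hb : 0 ≤ b) {m : ℕ} (hm : 1 ≤ m) {z : Fin m → X × ℝ}
    (hz : ∀ i, |(z i).2| = 1) :
    ∑ σ : Fin m → Bool, signedLossSup S b σ z ≤
      b * m * 2 ^ m * empiricalRademacher (asPairClass S) z := by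
  have hcontr := sum_iSup_signs_le (ι := scaledHull S b) (u := fun _ => 0)
    (s := fun i f => logisticLoss ((f : X → ℝ) (z i).1 * (z i).2))
    (t := fun i f => (f : X → ℝ) (z i).1)
    (fun i p q => by
      refine (abs_logisticLoss_sub_le _ _).trans (le_of_eq ?_)
      rw [← sub_mul, abs_mul, hz i, mul_one])
    ⟨0, by simp⟩
    ⟨1 + b, fun i f => by simpa [hz i] using abs_logisticLoss_mul_le hSbound hb f.2 (z i)⟩
    ⟨b, fun i f => abs_le_of_mem_scaledHull hSbound hb f.2 _⟩
  simp only [zero_add] at hcontr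
  refine hcontr.trans (le_of_eq ?_)
  have hlin : ∀ σ : Fin m → Bool,
      (⨆ f : scaledHull S b, ∑ i, signValue (σ i) * (f : X → ℝ) (z i).1) =
      b * ⨆ g : S, ∑ i, signValue (σ i) * (g : X → ℝ) (z i).1 := fun σ => by
    have := iSup_scaledHull_apply hSneg hb
      (weightedSum (fun i => signValue (σ i)) fun i => (z i).1)
      (fun g hg => abs_weightedSum_le hSbound _ _ hg)
    simpa only [weightedSum_apply] using this
  have hm0 : (m : ℝ) ≠ 0 := by positivity
  unfold empiricalRademacher
  simp_rw [hlin, fun σ : Fin m → Bool => iSup_asPairClass S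
    (fun g => (1 / (m : ℝ)) * ∑ i, signValue (σ i) * g (z i)),
    ← Real.mul_iSup_of_nonneg (show 0 ≤ 1 / (m : ℝ) by positivity), ← Finset.mul_sum]
  field_simp

lemma integrable_empiricalRademacher {S : Set (X → ℝ)} (hSbound : ∀ g ∈ S, ∀ x, |g x| ≤ 1)
    (hSclass : IsMeasurableClass D (asPairClass S)) (m : ℕ) :
    Integrable (fun z => empiricalRademacher (asPairClass S) z)
      (Measure.pi fun _ : Fin m => D) := by
  refine (integrable_finsetSum _ fun σ _ => ?_).const_mul _
  refine Integrable.of_bound (C := (1 / (m : ℝ)) * ∑ _i : Fin m, 1) ?_ (Eventually.of_forall ?_)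
  · have := (hSclass m fun i => (1 / (m : ℝ)) * signValue (σ i)).aestronglyMeasurable
    simpa only [Finset.mul_sum, mul_assoc] using this
  · intro z
    rw [iSup_asPairClass S (fun g => (1 / (m : ℝ)) * ∑ i, signValue (σ i) * g (z i)),
      Real.norm_eq_abs]
    rcases isEmpty_or_nonempty S with h | h
    · rw [Real.iSup_of_isEmpty, abs_zero]
      positivity
    · refine abs_ciSup_le fun g => ?_
      rw [abs_mul, abs_of_nonneg (show 0 ≤ 1 / (m : ℝ) by positivity)]
      refine mul_le_mul_of_nonneg_left ((abs_sum_signValue_mul_le σ _).trans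
        (Finset.sum_le_sum fun i _ => hSbound g g.2 _)) (by positivity)

/-- The generalization bound, in a form which does not need the supremum of the deviations over
the hypothesis class to be measurable: any integrable function of the sample which is bounded by
the deviation of some member of the class has expectation at most `2 b R_m(S)`. -/
lemma integral_le_of_le_risk_sub_empiricalRisk (hY : ∀ᵐ z ∂D, z.2 = 1 ∨ z.2 = -1)
    {S : Set (X → ℝ)} (hSmeas : ∀ g ∈ S, Measurable g) (hSbound : ∀ g ∈ S, ∀ x, |g x| ≤ 1)
    (hSneg : ∀ g ∈ S, -g ∈ S) (hSclass : IsMeasurableClass D (asPairClass S)) {b : ℝ}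
    (hb : 0 ≤ b) {m : ℕ} (hm : 1 ≤ m) {H : (Fin m → X × ℝ) → ℝ}
    (hH : Integrable H (Measure.pi fun _ : Fin m => D))
    (hdev : ∀ᵐ z ∂(Measure.pi fun _ : Fin m => D), ∃ f ∈ scaledHull S b,
      H z ≤ risk D f - empiricalRisk z f) :
    ∫ z, H z ∂(Measure.pi fun _ : Fin m => D) ≤
      2 * b * rademacherComplexity D (asPairClass S) m := by
  set μ := Measure.pi fun _ : Fin m => D
  have hm0 : (0 : ℝ) < m := by exact_mod_cast hm
  have hint : ∀ σ : Fin m → Bool, Integrable (signedLossSup S b σ) μ := fun σ =>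
    integrable_signedLossSup hY hSbound hSneg hSclass hb σ
  have hflip : ∀ σ : Fin m → Bool, m * ∫ z, H z ∂μ ≤
      (∫ z, signedLossSup S b σ z ∂μ) + ∫ z, signedLossSup S b (fun i => !σ i) z ∂μ := by
    intro σ
    have hi : ∀ σ τ : Fin m → Bool,
        Integrable (fun p => signedLossSup S b σ (mixSamples τ p)) (μ.prod μ) := fun σ τ =>
      ((measurePreserving_mixSamples D τ).integrable_comp
        (hint σ).aestronglyMeasurable).mpr (hint σ)
    have hG := (hi σ fun i => !σ i).add (hi (fun i => !σ i) σ)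
    rw [← integral_comp_mixSamples D (fun i => !σ i) (hint σ).aestronglyMeasurable,
      ← integral_comp_mixSamples D σ (hint fun i => !σ i).aestronglyMeasurable,
      ← integral_add (hi σ fun i => !σ i) (hi (fun i => !σ i) σ), ← integral_const_mul]
    refine le_trans ?_ (integral_prod _ hG).ge
    refine integral_mono_ae (hH.const_mul _) hG.integral_prod_left ?_
    filter_upwards [hdev, hG.prod_right_ae] with z ⟨f, hf, hHz⟩ hGz
    have hloss := integrable_loss hY (measurable_of_mem_span hSmeas
      (scaledHull_subset_span S b hf)) (abs_le_of_mem_scaledHull hSbound hb hf)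
    have hemp := integrable_empiricalRisk hloss m
    have hrisk : m * (risk D f - empiricalRisk z f) =
        ∫ z', m * (empiricalRisk z' f - empiricalRisk z f) ∂μ := by
      rw [integral_const_mul, integral_sub hemp (integrable_const _),
        integral_empiricalRisk hloss hm]
      simp
    refine (mul_le_mul_of_nonneg_left hHz hm0.le).trans (hrisk.le.trans ?_)
    refine integral_mono ((hemp.sub (integrable_const _)).const_mul _) hGz fun z' => ?_
    refine le_trans (le_of_eq ?_) (sum_loss_sub_le hSbound hb σ z z' hf)
    unfold empiricalRisk
    field_simp
  have hinv : Function.Involutive fun (σ : Fin m → Bool) i => !σ i := fun σ => by simp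
  have hperm : ∑ σ : Fin m → Bool, ∫ z, signedLossSup S b (fun i => !σ i) z ∂μ =
      ∑ σ : Fin m → Bool, ∫ z, signedLossSup S b σ z ∂μ :=
    Equiv.sum_comp hinv.toPerm fun σ => ∫ z, signedLossSup S b σ z ∂μ
  have hsum := Finset.sum_le_sum fun (σ : Fin m → Bool) (_ : σ ∈ Finset.univ) => hflip σ
  rw [Finset.sum_add_distrib, hperm, ← two_mul, ← integral_finsetSum _ fun σ _ => hint σ] at hsum
  have hbound : ∫ z, ∑ σ : Fin m → Bool, signedLossSup S b σ z ∂μ ≤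
      b * m * 2 ^ m * rademacherComplexity D (asPairClass S) m := by
    unfold rademacherComplexity
    rw [← integral_const_mul]
    refine integral_mono_ae (integrable_finsetSum _ fun σ _ => hint σ)
      ((integrable_empiricalRademacher hSbound hSclass m).const_mul _) ?_
    filter_upwards [ae_abs_label_eq_one hY m] with z hz
    exact sum_signedLossSup_le hSbound hSneg hb hm hz
  simp only [Finset.sum_const, Finset.card_univ, Fintype.card_fun, Fintype.card_bool,
    Fintype.card_fin, nsmul_eq_mul, Nat.cast_pow, Nat.cast_ofNat] at hsum
  have hpos : (0 : ℝ) < 2 ^ m * m := by positivity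
  refine le_of_mul_le_mul_left ?_ hpos
  linarith

end Generalization

/-! ### Greedy boosting with the logistic loss -/

/-- The empirical risk is convex, with second derivative at most `1` along the elements of the
basis. -/
lemma exists_tangent_empiricalRisk {S : Set (X → ℝ)} (hS : ∀ g ∈ S, ∀ x, |g x| ≤ 1) {m : ℕ}
    (hm : 1 ≤ m) {z : Fin m → X × ℝ} (hz : ∀ i, |(z i).2| = 1) (f : X → ℝ) :
    ∃ ℓ : (X → ℝ) →ₗ[ℝ] ℝ,
      (∀ f', empiricalRisk z f + ℓ (f' - f) ≤ empiricalRisk z f') ∧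
      ∀ g ∈ S, ∀ α : ℝ,
        empiricalRisk z (f + α • g) ≤ empiricalRisk z f + α * ℓ g + α ^ 2 / 2 := by
  have hm0 : (0 : ℝ) < m := by exact_mod_cast hm
  refine ⟨weightedSum (fun i => (1 / (m : ℝ)) *
    (logisticLossDeriv (f (z i).1 * (z i).2) * (z i).2)) (fun i => (z i).1), ?_, ?_⟩
  · intro f'
    rw [weightedSum_apply]
    unfold empiricalRisk
    rw [Finset.mul_sum, Finset.mul_sum, ← Finset.sum_add_distrib]
    refine Finset.sum_le_sum fun i _ => ?_
    have h := mul_le_mul_of_nonneg_left (logisticLoss_tangent_le (f (z i).1 * (z i).2)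
      (f' (z i).1 * (z i).2)) (show 0 ≤ 1 / (m : ℝ) by positivity)
    refine le_trans (le_of_eq ?_) h
    simp only [Pi.sub_apply]
    ring
  · intro g hg α
    rw [weightedSum_apply]
    unfold empiricalRisk
    have hquad : α ^ 2 / 2 = ∑ _i : Fin m, 1 / (m : ℝ) * (α ^ 2 / 2) := by
      simp only [Finset.sum_const, Finset.card_univ, Fintype.card_fin, nsmul_eq_mul]
      field_simp
    rw [hquad, Finset.mul_sum, Finset.mul_sum, Finset.mul_sum, ← Finset.sum_add_distrib,
      ← Finset.sum_add_distrib]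
    refine Finset.sum_le_sum fun i _ => ?_
    have h := logisticLoss_le_quadratic (f (z i).1 * (z i).2) ((f + α • g) (z i).1 * (z i).2)
    simp only [Pi.add_apply, Pi.smul_apply, smul_eq_mul] at h ⊢
    have hsq : ((f (z i).1 + α * g (z i).1) * (z i).2 - f (z i).1 * (z i).2) ^ 2 ≤ α ^ 2 := by
      rw [show (f (z i).1 + α * g (z i).1) * (z i).2 - f (z i).1 * (z i).2 =
        α * (g (z i).1 * (z i).2) by ring, mul_pow]
      refine mul_le_of_le_one_right (sq_nonneg _) ?_
      rw [sq_le_one_iff_abs_le_one, abs_mul, hz i, mul_one]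
      exact hS g hg _
    have h' := mul_le_mul_of_nonneg_left (h.trans (add_le_add_right
      (div_le_div_of_nonneg_right hsq zero_le_two) _)) (show 0 ≤ 1 / (m : ℝ) by positivity)
    refine h'.trans (le_of_eq ?_)
    ring

lemma empiricalRisk_nonneg {m : ℕ} (z : Fin m → X × ℝ) (f : X → ℝ) : 0 ≤ empiricalRisk z f :=
  mul_nonneg (by positivity) (Finset.sum_nonneg fun _ _ => logisticLoss_nonneg _)

lemma empiricalRisk_zero_le {m : ℕ} (z : Fin m → X × ℝ) : empiricalRisk z 0 ≤ 1 := by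
  unfold empiricalRisk
  simp only [Pi.zero_apply, zero_mul, Finset.sum_const, Finset.card_univ, Fintype.card_fin,
    nsmul_eq_mul]
  rcases Nat.eq_zero_or_pos m with rfl | hm
  · simp
  · have : (m : ℝ) ≠ 0 := by positivity
    field_simp
    exact logisticLoss_zero_le

/-- The empirical risk of the boosting estimator, compared with that of a reference function. -/
lemma IsGreedyBoosting.empiricalRisk_le {S : Set (X → ℝ)} (hSbound : ∀ g ∈ S, ∀ x, |g x| ≤ 1)
    (hSneg : ∀ g ∈ S, -g ∈ S) {m : ℕ} (hm : 1 ≤ m) {z : Fin m → X × ℝ}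
    (hz : ∀ i, |(z i).2| = 1) {Λ : ℕ → Set ℝ} {ε : ℕ → ℝ} {K : ℕ} {f : ℕ → X → ℝ}
    (hf : IsGreedyBoosting S (empiricalRisk z) 0 Λ ε K f) {h : ℝ} (hh : 0 < h)
    (hΛ : ∀ j < K, IsLUB (Λ j) h) (hε : ∀ j < K, ε j ≤ h ^ 2 / 2) {fbar : X → ℝ}
    (hfbar : fbar ∈ Submodule.span ℝ S) :
    empiricalRisk z (f K) ≤ empiricalRisk z fbar +
      oneNorm S fbar / (oneNorm S fbar + K * h) + K * h ^ 2 := by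
  have hN := oneNorm_nonneg S fbar
  have hKh : 0 ≤ K * h := by positivity
  rcases (add_nonneg hN hKh).eq_or_lt with h0 | hpos
  · -- the degenerate case: no step is made, and the reference function is zero
    have hN0 : oneNorm S fbar = 0 := by linarith
    have hK0 : K = 0 := by
      have : (K : ℝ) * h = 0 := by linarith
      simpa [hh.ne'] using this
    have hfbar0 : fbar = 0 := funext fun x => by
      simpa [hN0] using abs_le_oneNorm hSbound hfbar x
    subst hK0
    rw [hf.start, ← hfbar0, hN0]
    simp
  · have hexc := hf.excess_le hSneg (exists_tangent_empiricalRisk hSbound hm hz) hh hΛ hε hfbar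
    have h1 : max (empiricalRisk z 0 - empiricalRisk z fbar) 0 ≤ 1 :=
      max_le (by linarith [empiricalRisk_zero_le z, empiricalRisk_nonneg z fbar]) zero_le_one
    have h2 := mul_le_mul_of_nonneg_left h1 hN
    have h3 : max (empiricalRisk z (f K) - empiricalRisk z fbar) 0 ≤
        oneNorm S fbar / (oneNorm S fbar + K * h) + K * h ^ 2 := by
      have h4 : oneNorm S fbar / (oneNorm S fbar + K * h) + K * h ^ 2 =
          (oneNorm S fbar + (oneNorm S fbar + K * h) * (K * h ^ 2)) /
            (oneNorm S fbar + K * h) := by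
        field_simp
      rw [h4, le_div_iff₀ hpos]
      linarith
    linarith [le_max_left (empiricalRisk z (f K) - empiricalRisk z fbar) 0]

section Expectation

variable [MeasurableSpace X] {D : Measure (X × ℝ)} [IsProbabilityMeasure D]

/-- The expected risk of the boosting estimator with total step size `K h`, compared with the risk
of a reference function: the three additional terms come from the generalization bound, from the
numerical convergence, and from the second-order terms and tolerances. -/
lemma integral_risk_boosting_le (hY : ∀ᵐ z ∂D, z.2 = 1 ∨ z.2 = -1)
    {S : Set (X → ℝ)} (hSmeas : ∀ g ∈ S, Measurable g) (hSbound : ∀ g ∈ S, ∀ x, |g x| ≤ 1)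
    (hSneg : ∀ g ∈ S, -g ∈ S) (hSclass : IsMeasurableClass D (asPairClass S))
    {m : ℕ} (hm : 1 ≤ m) {h : ℝ} (hh : 0 < h) {K : ℕ}
    {Λ : (Fin m → X × ℝ) → ℕ → Set ℝ} {ε : (Fin m → X × ℝ) → ℕ → ℝ}
    {f : (Fin m → X × ℝ) → ℕ → X → ℝ}
    (hΛ : ∀ᵐ z ∂(Measure.pi fun _ : Fin m => D), ∀ j < K, IsLUB (Λ z j) h)
    (hε : ∀ᵐ z ∂(Measure.pi fun _ : Fin m => D), ∀ j < K, ε z j ≤ h ^ 2 / 2)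
    (hf : ∀ᵐ z ∂(Measure.pi fun _ : Fin m => D),
      IsGreedyBoosting S (empiricalRisk z) 0 (Λ z) (ε z) K (f z))
    (hQmeas : AEMeasurable (fun z => risk D (f z K)) (Measure.pi fun _ : Fin m => D)) :
    Integrable (fun z => risk D (f z K)) (Measure.pi fun _ : Fin m => D) ∧
      ∀ fbar ∈ Submodule.span ℝ S,
        ∫ z, risk D (f z K) ∂(Measure.pi fun _ : Fin m => D) ≤ risk D fbar +
          2 * (K * h) * rademacherComplexity D (asPairClass S) m +
          oneNorm S fbar / (oneNorm S fbar + K * h) + K * h ^ 2 := by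
  have hb : 0 ≤ K * h := by positivity
  have hrisk_nonneg : ∀ f : X → ℝ, 0 ≤ risk D f := fun f =>
    integral_nonneg fun _ => logisticLoss_nonneg _
  have hrisk_le : ∀ f ∈ scaledHull S (K * h), risk D f ≤ 1 + K * h := fun f hf => by
    have hbd := abs_le_of_mem_scaledHull hSbound hb hf
    have := integral_mono_ae (integrable_loss hY
      (measurable_of_mem_span hSmeas (scaledHull_subset_span _ _ hf)) hbd)
      (integrable_const (1 + K * h)) (by
        filter_upwards [hY] with z hz
        have h1 : |z.2| = 1 := by rcases hz with hz | hz <;> simp [hz]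
        have h2 := abs_logisticLoss_mul_le hSbound hb hf z
        rw [h1, mul_one] at h2
        exact (le_abs_self _).trans h2)
    simpa [risk] using this
  have hmem : ∀ᵐ z ∂(Measure.pi fun _ : Fin m => D), f z K ∈ scaledHull S (K * h) := by
    filter_upwards [hΛ, hf] with z hΛz hfz
    exact hfz.mem_scaledHull hSneg hh.le hΛz le_rfl
  have hint : Integrable (fun z => risk D (f z K)) (Measure.pi fun _ : Fin m => D) := by
    refine Integrable.of_bound hQmeas.aestronglyMeasurable (1 + K * h) ?_
    filter_upwards [hmem] with z hz
    rw [Real.norm_eq_abs, abs_of_nonneg (hrisk_nonneg _)]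
    exact hrisk_le _ hz
  refine ⟨hint, fun fbar hfbar => ?_⟩
  have hloss := integrable_loss hY (measurable_of_mem_span hSmeas hfbar)
    (abs_le_oneNorm hSbound hfbar)
  have hemp := integrable_empiricalRisk hloss m
  set c : ℝ := oneNorm S fbar / (oneNorm S fbar + K * h) + K * h ^ 2 with hc
  have hcomp : Integrable (fun z => empiricalRisk z fbar + c)
      (Measure.pi fun _ : Fin m => D) := hemp.add (integrable_const c)
  have hgen := integral_le_of_le_risk_sub_empiricalRisk hY hSmeas hSbound hSneg hSclass hb hm
    (hint.sub hcomp) (by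
      filter_upwards [hΛ, hε, hf, hmem, ae_abs_label_eq_one hY m] with z hΛz hεz hfz hmz hz
      refine ⟨f z K, hmz, ?_⟩
      have := hfz.empiricalRisk_le hSbound hSneg hm hz hh hΛz hεz hfbar
      simp only [Pi.sub_apply]
      linarith)
  simp only [Pi.sub_apply] at hgen
  rw [integral_sub hint hcomp, integral_add hemp (integrable_const c),
    integral_empiricalRisk hloss hm] at hgen
  simp only [integral_const, probReal_univ, one_smul] at hgen
  linarith

end Expectation

end Boosting

end

theorem theorem3p2 {X : Type*} [MeasurableSpace X]
    -- the distribution of `(X, Y)`, with `Y = ±1`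
    (D : Measure (X × ℝ)) [IsProbabilityMeasure D]
    (hY : ∀ᵐ z ∂D, z.2 = 1 ∨ z.2 = -1)
    -- the basis
    (S : Set (X → ℝ))
    (hSmeas : ∀ g ∈ S, Measurable g)
    (hSbound : ∀ g ∈ S, ∀ x, |g x| ≤ 1)
    (hSneg : ∀ g ∈ S, -g ∈ S)
    (hSclass : Boosting.IsMeasurableClass D (Boosting.asPairClass S))
    (C : ℝ) (hC : 0 < C)
    (hR : ∀ m : ℕ, 1 ≤ m →
      Boosting.rademacherComplexity D (Boosting.asPairClass S) m ≤ C / √(m : ℝ))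
    -- step size, total step size and number of steps for each sample size
    (h₀ : ℕ → ℝ) (β : ℕ → ℝ) (k : ℕ → ℕ)
    (hh₀ : ∀ m : ℕ, 1 ≤ m → 0 < h₀ m ∧ h₀ m ≤ 1 / √(m : ℝ))
    (hk : ∀ m : ℕ, 1 ≤ m → (k m : ℝ) = β m / h₀ m)
    -- greedy boosting on the sample `z` of size `m`, started at `0`
    (Λ : (m : ℕ) → (Fin m → X × ℝ) → ℕ → Set ℝ)
    (ε : (m : ℕ) → (Fin m → X × ℝ) → ℕ → ℝ)
    (f : (m : ℕ) → (Fin m → X × ℝ) → ℕ → X → ℝ)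
    (hΛ : ∀ m : ℕ, 1 ≤ m → ∀ᵐ z ∂(Measure.pi fun _ : Fin m => D),
      ∀ j < k m, IsLUB (Λ m z j) (h₀ m))
    (hε : ∀ m : ℕ, 1 ≤ m → ∀ᵐ z ∂(Measure.pi fun _ : Fin m => D),
      ∀ j < k m, ε m z j ≤ h₀ m ^ 2 / 2)
    (hf : ∀ m : ℕ, 1 ≤ m → ∀ᵐ z ∂(Measure.pi fun _ : Fin m => D),
      Boosting.IsGreedyBoosting S (Boosting.empiricalRisk z) 0 (Λ m z) (ε m z) (k m) (f m z))
    -- the risk of the boosting estimator is a random variable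
    (hQmeas : ∀ m : ℕ, 1 ≤ m → AEMeasurable (fun z => Boosting.risk D (f m z (k m)))
      (Measure.pi fun _ : Fin m => D)) :
    -- the bound
    (∀ m : ℕ, 1 ≤ m →
      Integrable (fun z => Boosting.risk D (f m z (k m))) (Measure.pi fun _ : Fin m => D) ∧
      ∫ z, Boosting.risk D (f m z (k m)) ∂(Measure.pi fun _ : Fin m => D) ≤
        ⨅ fbar : Submodule.span ℝ S,
          (Boosting.risk D fbar + (2 * C + 1) * β m / √(m : ℝ)
            + (Boosting.oneNorm S fbar + 1) / √(m : ℝ)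
            + Boosting.oneNorm S fbar / (Boosting.oneNorm S fbar + β m))) ∧
    -- the rate for `β_m` of order `m^{1/4}`
    (∀ c₁ c₂ : ℝ, 0 < c₁ → 0 < c₂ →
      (∀ᶠ m : ℕ in atTop,
        c₁ * (m : ℝ) ^ (1 / 4 : ℝ) ≤ β m ∧ β m ≤ c₂ * (m : ℝ) ^ (1 / 4 : ℝ)) →
      ∀ fbar ∈ Submodule.span ℝ S, ∀ᶠ m : ℕ in atTop,
        ∫ z, Boosting.risk D (f m z (k m)) ∂(Measure.pi fun _ : Fin m => D) ≤
          Boosting.risk D fbar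
            + ((2 * C + 1) * c₂ + (Boosting.oneNorm S fbar + 1) + Boosting.oneNorm S fbar / c₁)
              * (m : ℝ) ^ (-(1 / 4) : ℝ)) ∧
    -- the rate for `β_m` of order `‖fbar‖₁^{1/2} m^{1/4}`
    (∀ c₁ c₂ : ℝ, 0 < c₁ → 0 < c₂ → ∀ fbar ∈ Submodule.span ℝ S,
      (∀ᶠ m : ℕ in atTop,
        c₁ * √(Boosting.oneNorm S fbar) * (m : ℝ) ^ (1 / 4 : ℝ) ≤ β m ∧
        β m ≤ c₂ * √(Boosting.oneNorm S fbar) * (m : ℝ) ^ (1 / 4 : ℝ)) →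
      ∀ᶠ m : ℕ in atTop,
        ∫ z, Boosting.risk D (f m z (k m)) ∂(Measure.pi fun _ : Fin m => D) ≤
          Boosting.risk D fbar
            + ((2 * C + 1) * c₂ + 1 + 1 / c₁)
              * √(Boosting.oneNorm S fbar) * (m : ℝ) ^ (-(1 / 4) : ℝ)) := by
  have hbound : ∀ m : ℕ, 1 ≤ m →
      Integrable (fun z => Boosting.risk D (f m z (k m))) (Measure.pi fun _ : Fin m => D) ∧
      ∀ fbar ∈ Submodule.span ℝ S,
        ∫ z, Boosting.risk D (f m z (k m)) ∂(Measure.pi fun _ : Fin m => D) ≤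
          Boosting.risk D fbar + (2 * C + 1) * β m / √(m : ℝ)
            + Boosting.oneNorm S fbar / (Boosting.oneNorm S fbar + β m) := by
    intro m hm
    obtain ⟨hh, hh1⟩ := hh₀ m hm
    obtain ⟨hint, hle⟩ := Boosting.integral_risk_boosting_le hY hSmeas hSbound hSneg hSclass hm hh
      (hΛ m hm) (hε m hm) (hf m hm) (hQmeas m hm)
    have hβ : (k m : ℝ) * h₀ m = β m := by
      rw [hk m hm]; field_simp
    have hβ0 : 0 ≤ β m := by rw [← hβ]; positivity
    refine ⟨hint, fun fbar hfbar => (hle fbar hfbar).trans ?_⟩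
    rw [hβ, show (k m : ℝ) * h₀ m ^ 2 = β m * h₀ m by rw [← hβ]; ring]
    have h1 := mul_le_mul_of_nonneg_left (hR m hm) (show 0 ≤ 2 * β m by positivity)
    have h2 := mul_le_mul_of_nonneg_left hh1 hβ0
    have h3 : (2 * C + 1) * β m / √(m : ℝ) = 2 * β m * (C / √m) + β m * (1 / √m) := by ring
    linarith
  -- powers of the sample size
  have hpow : ∀ m : ℕ, 1 ≤ m → 0 < (m : ℝ) ^ (1 / 4 : ℝ) ∧
      (m : ℝ) ^ (-(1 / 4) : ℝ) = ((m : ℝ) ^ (1 / 4 : ℝ))⁻¹ ∧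
      √(m : ℝ) = (m : ℝ) ^ (1 / 4 : ℝ) * (m : ℝ) ^ (1 / 4 : ℝ) := by
    intro m hm
    have hm0 : (0 : ℝ) < m := by exact_mod_cast hm
    refine ⟨by positivity, Real.rpow_neg hm0.le _, ?_⟩
    rw [Real.sqrt_eq_rpow, ← Real.rpow_add hm0]
    norm_num
  refine ⟨fun m hm => ⟨(hbound m hm).1, le_ciInf fun fbar => ?_⟩, ?_, ?_⟩
  · have h1 := (hbound m hm).2 fbar fbar.2
    have h2 : 0 ≤ (Boosting.oneNorm S fbar + 1) / √(m : ℝ) :=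
      div_nonneg (by linarith [Boosting.oneNorm_nonneg S fbar]) (Real.sqrt_nonneg _)
    linarith
  · intro c₁ c₂ hc₁ hc₂ hβ fbar hfbar
    filter_upwards [hβ, eventually_ge_atTop 1] with m hβm hm
    obtain ⟨hlow, hupp⟩ := hβm
    obtain ⟨hr, hrinv, hsqrt⟩ := hpow m hm
    refine ((hbound m hm).2 fbar hfbar).trans ?_
    rw [hrinv, hsqrt]
    set r := (m : ℝ) ^ (1 / 4 : ℝ)
    have hN := Boosting.oneNorm_nonneg S fbar
    set N := Boosting.oneNorm S fbar
    have h1 : (2 * C + 1) * β m / (r * r) ≤ (2 * C + 1) * c₂ * r⁻¹ := by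
      rw [div_le_iff₀ (by positivity)]
      have : (2 * C + 1) * c₂ * r⁻¹ * (r * r) = (2 * C + 1) * (c₂ * r) := by field_simp
      rw [this]
      exact mul_le_mul_of_nonneg_left hupp (by positivity)
    have h2 : N / (N + β m) ≤ N / c₁ * r⁻¹ := by
      have : N / c₁ * r⁻¹ = N / (c₁ * r) := by field_simp
      rw [this]
      exact div_le_div_of_nonneg_left hN (by positivity) (by linarith)
    have h3 : 0 ≤ (N + 1) * r⁻¹ := by positivity
    linarith
  · intro c₁ c₂ hc₁ hc₂ fbar hfbar hβ
    filter_upwards [hβ, eventually_ge_atTop 1] with m hβm hm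
    obtain ⟨hlow, hupp⟩ := hβm
    obtain ⟨hr, hrinv, hsqrt⟩ := hpow m hm
    refine ((hbound m hm).2 fbar hfbar).trans ?_
    rw [hrinv, hsqrt]
    set r := (m : ℝ) ^ (1 / 4 : ℝ)
    have hN := Boosting.oneNorm_nonneg S fbar
    have hNs := Real.mul_self_sqrt hN
    have hs := Real.sqrt_nonneg (Boosting.oneNorm S fbar)
    set N := Boosting.oneNorm S fbar
    set s := √N
    have h1 : (2 * C + 1) * β m / (r * r) ≤ (2 * C + 1) * c₂ * s * r⁻¹ := by
      rw [div_le_iff₀ (by positivity)]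
      have : (2 * C + 1) * c₂ * s * r⁻¹ * (r * r) = (2 * C + 1) * (c₂ * s * r) := by field_simp
      rw [this]
      exact mul_le_mul_of_nonneg_left hupp (by positivity)
    have h2 : N / (N + β m) ≤ 1 / c₁ * s * r⁻¹ := by
      rcases hs.eq_or_lt with h0 | hpos
      · -- here the 1-norm vanishes, and both sides are `0`
        rw [← h0] at hNs ⊢
        rw [← hNs]
        simp
      · have : 1 / c₁ * s * r⁻¹ = N / (c₁ * s * r) := by
          rw [← hNs]; field_simp
        rw [this]
        exact div_le_div_of_nonneg_left hN (by positivity) (by linarith)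
    have h3 : 0 ≤ s * r⁻¹ := by positivity
    linarith
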